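/- Let $(\mathcal S,\mathcal A,\mathcal P,r,\gamma)$ be a finite Markov decision process with state space $\mathcal S=\{1,\dots,n\}$, transition probabilities $\mathcal P(s'|s,a)$, deterministic rewards $r(s,a,s')$ with $|r(s,a,s')|\le r_{\max}$, and discount factor $\gamma\in(0,1)$. Let $\mu$ be a stationary policy whose transition matrix $P(s,s')=\sum_a\mu(s,a)\mathcal P(s'|s,a)$ is irreducible and aperiodic, with stationary distribution $\pi$, and let $m>0$, $\rho\in(0,1)$ be constants with $\max_s d_{\rm TV}(P^t(s,\cdot),\pi)\le m\rho^t$ for all integers $t\ge 0$, where $d_{\rm TV}(p,q)=\frac12\sum_s|p(s)-q(s)|$. For $\epsilon>0$ put $\tau^{\rm mix}(\epsilon)=\min\{t\ge 1: m\rho^t\le\epsilon\}$. Write $\|v\|_D^2=\sum_s\pi_s v(s)^2$. Let $(s_t,a_t)_{t\ge 0}$ be the trajectory of states and actions generated by $\mu$ with $s_0\sim\pi$, put $r_t=r(s_t,a_t,s_{t+1})$, and let $V(s)=E\big[\sum_{t\ge 0}\gamma^t r_t\,\big|\,s_0=s\big]$ be the value function. Let $\phi_1,\dots,\phi_K:\mathcal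 S\to\mathbb R$ be linearly independent features such that $\phi(s)=(\phi_1(s),\dots,\phi_K(s))$ satisfies $\|\phi(s)\|_2\le 1$ for every $s$, and let $V_\theta(s)=\theta^T\phi(s)$ for $\theta\in\mathbb R^K$. Let $\theta^*$ be the solution of the projected Bellman equation: $V_{\theta^*}$ is the $\|\cdot\|_D$-orthogonal projection onto $\{V_\theta:\theta\in\mathbb R^K\}$ of the function $s\mapsto\sum_{a,s'}\mu(s,a)\mathcal P(s'|s,a)\left(r(s,a,s')+\gamma V_{\theta^*}(s')\right)$. Let $\Theta\subset\mathbb R^K$ be a closed convex set that contains $\theta^*$ and all of whose elements have Euclidean norm at most $R$, and let $G=r_{\max}+2R$. Mean-adjusted TD(0) starts at a deterministic $\theta_0\in\mathbb R^K$ and iterates $$\theta_{t+1}={\rm Proj}_\Theta\Big(\theta_t+\alpha_t\big(r_t+\gamma\,\theta_t^T\phi(s_{t+1})-\theta_t^T\phi(s_t)\big)\phi(s_t)\Big),\qquad \bar A_t=\frac{t\bar A_{t-1}+r_t}{t+1},\quad \bar A_{-1}=0.$$ With $\bar\theta_T=\frac1T\sum_{t=0}^{T-1}\theta_t$ and $\hat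 V_T=\bar A_T/(1-\gamma)$ it outputs $V'_T=V_{\bar\theta_T}+\left(\hat V_T-\pi^TV_{\bar\theta_T}\right)\mathbf 1$. Let $r(P)=1/(1-\lambda_2(Q))$, where $\lambda_2(Q)$ is the second largest eigenvalue (with multiplicity) of the additive reversibilization $Q=(P+P^*)/2$, $P^*(i,j)=\pi_jP(j,i)/\pi_i$, of $P$ (if $n=1$, put $r(P)=1$). Let $t_0$ be the largest integer with $t_0\le 2\tau^{\rm mix}\big(\frac1{2(t_0+1)}\big)$. Then there is an absolute constant $C>0$, independent of all the data above, such that if $T\ge t_0$ and $\alpha_0=\dots=\alpha_T=1/\sqrt T$, then $$E\,\|V'_T-V\|_D^2\le C\left(\|V_{\theta^*}-V\|_D^2+\frac{r_{\max}^2\,\tau^{\rm mix}\big(\frac1{2(T+1)}\big)}{(1-\gamma)^2\,T}+\frac{\|\theta^*-\theta_0\|_2^2+G^2\big[1+\tau^{\rm mix}(1/\sqrt T)\big]}{\sqrt T}\,\min\Big\{\frac{r(P)}{\gamma},\frac1{1-\gamma}\Big\}\right).$$ -/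

import Mathlib

open MeasureTheory

noncomputable section

namespace MeanAdjustedTD

/-- A finite discounted Markov decision process with deterministic rewards. -/
structure MDP (S A : Type*) [Fintype S] where
  /-- `trans s a s'` is the probability of moving from `s` to `s'` under action `a`. -/
  trans : S → A → S → ℝ
  trans_mem : ∀ s a, trans s a ∈ stdSimplex ℝ S
  reward : S → A → S → ℝ
  discount : ℝ
  discount_pos : 0 < discount
  discount_lt_one : discount < 1

variable {S A κ Ω : Type*} [Fintype S] [DecidableEq S] [Fintype A] [Fintype κ]

/-- A stationary policy: a probability distribution on actions for every state. -/
def IsPolicy (μ : S → A → ℝ) : Prop := ∀ s, μ s ∈ stdSimplex ℝ A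

/-- The transition matrix of the Markov chain induced by the policy `μ`. -/
def transMatrix (M : MDP S A) (μ : S → A → ℝ) : Matrix S S ℝ :=
  Matrix.of fun s s' => ∑ a, μ s a * M.trans s a s'

/-- Aperiodicity: for every state the greatest common divisor of the return times is one. -/
def IsAperiodic (P : Matrix S S ℝ) : Prop :=
  ∀ (s : S) (d : ℕ), (∀ t : ℕ, 1 ≤ t → 0 < (P ^ t) s s → d ∣ t) → d = 1

/-- `p` is a stationary distribution of the stochastic matrix `P`. -/
def IsStationary (P : Matrix S S ℝ) (p : S → ℝ) : Prop :=
  p ∈ stdSimplex ℝ S ∧ Matrix.vecMul p P = p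

/-- Total variation distance of two probability vectors. -/
def tvDist (p q : S → ℝ) : ℝ := (1 / 2) * ∑ s, |p s - q s|

/-- Uniform geometric mixing with constants `m` and `ρ`. -/
def MixesGeometrically (P : Matrix S S ℝ) (p : S → ℝ) (m ρ : ℝ) : Prop :=
  ∀ (t : ℕ) (s : S), tvDist ((P ^ t) s) p ≤ m * ρ ^ t

/-- The mixing time: the least `t ≥ 1` with `m ρ ^ t ≤ ε`. -/
def mixTime (m ρ ε : ℝ) : ℕ := sInf {t : ℕ | 1 ≤ t ∧ m * ρ ^ t ≤ ε}

/-- The squared norm `‖v‖_D²`, where `D` is the diagonal matrix with diagonal `p`. -/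
def normSqD (p : S → ℝ) (v : S → ℝ) : ℝ := ∑ s, p s * v s ^ 2

/-- The mean `pᵀ v`. -/
def mean (p : S → ℝ) (v : S → ℝ) : ℝ := ∑ s, p s * v s

/-- The additive reversibilization `(P + P*) / 2`, where `P*(i, j) = p j * P(j, i) / p i`. -/
def additiveReversibilization (P : Matrix S S ℝ) (p : S → ℝ) : Matrix S S ℝ :=
  Matrix.of fun i j => (P i j + p j / p i * P j i) / 2

/-- The second largest eigenvalue of a real matrix with real spectrum, counted with
multiplicity. For a one-by-one matrix, which has no second eigenvalue, the value is `0`. -/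
def secondEigenvalue (Q : Matrix S S ℝ) : ℝ :=
  (Q.charpoly.roots.sort (fun x y : ℝ => x ≥ y)).getD 1 0

/-- The inverse spectral gap `1 / (1 - λ₂(Q))` of the additive reversibilization `Q` of `P`. -/
def invSpectralGap (P : Matrix S S ℝ) (p : S → ℝ) : ℝ :=
  1 / (1 - secondEigenvalue (additiveReversibilization P p))

/-- The random state-action sequence `(s t, a t)` on `(Ω, ℙ)` is generated by the MDP `M` under
the policy `μ`, with initial state distribution `p` (its finite-dimensional laws). -/
structure IsTrajectory [MeasurableSpace Ω] (M : MDP S A) (μ : S → A → ℝ) (p : S → ℝ)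
    (ℙ : Measure Ω) (s : ℕ → Ω → S) (a : ℕ → Ω → A) : Prop where
  measurableSet_state : ∀ t x, MeasurableSet (s t ⁻¹' {x})
  measurableSet_action : ∀ t b, MeasurableSet (a t ⁻¹' {b})
  law : ∀ (t : ℕ) (x : ℕ → S) (b : ℕ → A),
    ℙ.real {ω | (∀ i < t, s i ω = x i ∧ a i ω = b i) ∧ s t ω = x t} =
      p (x 0) * ∏ i ∈ Finset.range t, μ (x i) (b i) * M.trans (x i) (b i) (x (i + 1))

/-- The reward of the `t`-th transition along a path of states `s` and actions `a`. -/
def rewardAt (M : MDP S A) (s : ℕ → S) (a : ℕ → A) (t : ℕ) : ℝ :=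
  M.reward (s t) (a t) (s (t + 1))

/-- The value function: the expected discounted total reward of the trajectory, given that the
initial state is `x`. -/
def valueFunction [MeasurableSpace Ω] (M : MDP S A) (ℙ : Measure Ω)
    (s : ℕ → Ω → S) (a : ℕ → Ω → A) (x : S) : ℝ :=
  ∫ ω, (∑' t : ℕ, M.discount ^ t * rewardAt M (fun i => s i ω) (fun i => a i ω) t)
    ∂(ProbabilityTheory.cond ℙ (s 0 ⁻¹' {x}))

/-- The Bellman operator of the policy `μ`. -/
def bellman (M : MDP S A) (μ : S → A → ℝ) (v : S → ℝ) (s : S) : ℝ :=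
  ∑ a, ∑ s', μ s a * M.trans s a s' * (M.reward s a s' + M.discount * v s')

/-- The linear approximation `V_θ(s) = ∑ l, θ_l φ_l(s)`. -/
def linValue (φ : S → EuclideanSpace ℝ κ) (θ : EuclideanSpace ℝ κ) (s : S) : ℝ :=
  ∑ l, θ l * φ s l

/-- `θ` solves the projected Bellman equation: `V_θ` is the orthogonal projection, for the norm
`‖·‖_D`, of its image under the Bellman operator onto the space of all `V_θ'`. -/
def IsProjectedBellmanFixedPoint (M : MDP S A) (μ : S → A → ℝ) (p : S → ℝ)
    (φ : S → EuclideanSpace ℝ κ) (θ : EuclideanSpace ℝ κ) : Prop :=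
  ∀ θ' : EuclideanSpace ℝ κ,
    normSqD p (bellman M μ (linValue φ θ) - linValue φ θ) ≤
      normSqD p (bellman M μ (linValue φ θ) - linValue φ θ')

/-- The Euclidean projection onto `Θ`: a nearest point of `Θ` (which exists and is unique when
`Θ` is closed, convex and nonempty). -/
def proj (Θ : Set (EuclideanSpace ℝ κ)) (x : EuclideanSpace ℝ κ) : EuclideanSpace ℝ κ :=
  Classical.epsilon fun y => y ∈ Θ ∧ ∀ z ∈ Θ, ‖x - y‖ ≤ ‖x - z‖

/-- The TD(0) direction `g_t(θ)` along a path. -/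
def tdDirection (M : MDP S A) (φ : S → EuclideanSpace ℝ κ) (s : ℕ → S) (a : ℕ → A)
    (t : ℕ) (θ : EuclideanSpace ℝ κ) : EuclideanSpace ℝ κ :=
  (rewardAt M s a t + M.discount * linValue φ θ (s (t + 1)) - linValue φ θ (s t)) • φ (s t)

/-- The iterates `θ_t` of projected TD(0) with step sizes `α` along a path. -/
def tdIterate (M : MDP S A) (φ : S → EuclideanSpace ℝ κ) (Θ : Set (EuclideanSpace ℝ κ))
    (α : ℕ → ℝ) (θ₀ : EuclideanSpace ℝ κ) (s : ℕ → S) (a : ℕ → A) : ℕ → EuclideanSpace ℝ κ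
  | 0 => θ₀
  | t + 1 => proj Θ (tdIterate M φ Θ α θ₀ s a t +
      α t • tdDirection M φ s a t (tdIterate M φ Θ α θ₀ s a t))

/-- The running average `θ̄_T = (1 / T) ∑_{t < T} θ_t`. -/
def tdAverage (M : MDP S A) (φ : S → EuclideanSpace ℝ κ) (Θ : Set (EuclideanSpace ℝ κ))
    (α : ℕ → ℝ) (θ₀ : EuclideanSpace ℝ κ) (s : ℕ → S) (a : ℕ → A) (T : ℕ) :
    EuclideanSpace ℝ κ :=
  (1 / (T : ℝ)) • ∑ t ∈ Finset.range T, tdIterate M φ Θ α θ₀ s a t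

/-- The running average reward `Ā_t = (t Ā_{t-1} + r_t) / (t + 1)`, with `Ā_{-1} = 0`. -/
def avgReward (M : MDP S A) (s : ℕ → S) (a : ℕ → A) : ℕ → ℝ
  | 0 => rewardAt M s a 0
  | t + 1 => ((t + 1 : ℝ) * avgReward M s a t + rewardAt M s a (t + 1)) / (t + 2 : ℝ)

/-- The output `V'_T = V_{θ̄_T} + (V̂_T - πᵀ V_{θ̄_T}) 1` of mean-adjusted TD(0), where
`V̂_T = Ā_T / (1 - γ)`. -/
def meanAdjustedOutput (M : MDP S A) (p : S → ℝ) (φ : S → EuclideanSpace ℝ κ)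
    (Θ : Set (EuclideanSpace ℝ κ)) (α : ℕ → ℝ) (θ₀ : EuclideanSpace ℝ κ)
    (s : ℕ → S) (a : ℕ → A) (T : ℕ) (x : S) : ℝ :=
  linValue φ (tdAverage M φ Θ α θ₀ s a T) x +
    (avgReward M s a T / (1 - M.discount) -
      mean p (linValue φ (tdAverage M φ Θ α θ₀ s a T)))

end MeanAdjustedTD

end

set_option linter.unusedSectionVars false

/-! Write `u = V_θ̄ - V`. Centring and then adding `V̂` makes the output error the sum of `u - πᵀu`
and the constant `V̂ - πᵀV`, which are `D`-orthogonal. So the squared error is the variance of `u`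
plus the squared error of the estimated mean (`normSqD_meanAdjustedOutput_sub_le`), and the variance
of `u` is at most `2 Var(V_{θ̄ - θ*}) + 2 ‖V_θ* - V‖²`.

The variance of `V_{θ̄ - θ*}` is where the spectral gap enters. In stationary mean, the inner
product of the TD direction with `θ - θ*` equals minus the energy `(1 - γ) ‖v‖² + γ ⟪v, v - P v⟫` of
`v = V_{θ - θ*}` (`transitionMean_tdProgress`). The first term of the energy controls the variance
with constant `1 / (1 - γ)`. The second controls it with constant `r(P) / γ`, by a Poincaré
inequality that does not need reversibility (`mul_variance_le_dirichletForm`). The usual telescoping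
of `‖θ_t - θ*‖²` then bounds the summed energies (`sum_integral_tdEnergy_le`), and convexity passes
from the iterates to their average. Markovian noise is handled by replacing `θ_t` with the iterate
`τ` steps earlier: the iterate has moved little since then, while the chain has nearly forgotten its
state (`integral_tdProgress_le_of_lag`).

For the mean, stationarity gives `πᵀV = r̄ / (1 - γ)` with `r̄` the stationary mean reward, and
covariances of rewards die out after the mixing time, so the average of `T + 1` rewards has variance
of order `τ / T` (`integral_avgReward_sub_sq_le`). -/

namespace MeanAdjustedTD

/-! ### Random quantities determined by a finite history -/

variable {S A Ω : Type*} [Fintype S] [DecidableEq S] [Fintype A]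

/-- The states and actions up to time `t`, without the action taken at time `t`. -/
def history (s : ℕ → Ω → S) (a : ℕ → Ω → A) (t : ℕ) (ω : Ω) : (Fin t → S × A) × S :=
  (fun i => (s i ω, a i ω), s t ω)

/-- The random element `X` is a function of the history up to time `t`. -/
def DependsOnHistory {β : Type*} (s : ℕ → Ω → S) (a : ℕ → Ω → A) (t : ℕ) (X : Ω → β) : Prop :=
  Function.FactorsThrough X (history s a t)

lemma history_eq_iff {s : ℕ → Ω → S} {a : ℕ → Ω → A} {t : ℕ} {ω ω' : Ω} :
    history s a t ω = history s a t ω' ↔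
      (∀ i < t, s i ω = s i ω' ∧ a i ω = a i ω') ∧ s t ω = s t ω' := by
  simp only [history, Prod.mk.injEq, funext_iff]
  exact and_congr_left' ⟨fun h i hi => h ⟨i, hi⟩, fun h i => h i i.2⟩

namespace DependsOnHistory

variable {β β' : Type*} {s : ℕ → Ω → S} {a : ℕ → Ω → A} {t : ℕ} {X : Ω → β} {Y : Ω → β'}

lemma mono (h : DependsOnHistory s a t X) {u : ℕ} (htu : t ≤ u) : DependsOnHistory s a u X := by
  intro ω ω' hω
  obtain ⟨h1, h2⟩ := history_eq_iff.1 hω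
  refine h (history_eq_iff.2 ⟨fun i hi => h1 i (hi.trans_le htu), ?_⟩)
  rcases htu.eq_or_lt with rfl | hlt
  exacts [h2, (h1 t hlt).1]

lemma comp (h : DependsOnHistory s a t X) (f : β → β') :
    DependsOnHistory s a t (fun ω => f (X ω)) := fun _ _ hω => congrArg f (h hω)

lemma comp₂ {β'' : Type*} (h : DependsOnHistory s a t X) (h' : DependsOnHistory s a t Y)
    (f : β → β' → β'') : DependsOnHistory s a t (fun ω => f (X ω) (Y ω)) :=
  fun _ _ hω => congrArg₂ f (h hω) (h' hω)

lemma const (c : β) : DependsOnHistory s a t (fun _ => c) := fun _ _ _ => rfl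

lemma state : DependsOnHistory s a t (s t) := fun _ _ hω => (history_eq_iff.1 hω).2

lemma action : DependsOnHistory s a (t + 1) (a t) :=
  fun _ _ hω => ((history_eq_iff.1 hω).1 t t.lt_succ_self).2

lemma sum {ι : Type*} (I : Finset ι) {F : ι → Ω → ℝ}
    (h : ∀ i ∈ I, DependsOnHistory s a t (F i)) :
    DependsOnHistory s a t (fun ω => ∑ i ∈ I, F i ω) :=
  fun _ _ hω => Finset.sum_congr rfl fun i hi => h i hi hω

end DependsOnHistory

/-- With the discrete σ-algebra on `ζ`, measurable fibres suffice for measurability of `Z`, and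
expectations become finite sums. This settles integrability once for everything that depends on a
finite history. -/
lemma integrable_integral_comp_fintype [MeasurableSpace Ω] {ℙ : Measure Ω} [IsFiniteMeasure ℙ]
    {ζ : Type*} [Fintype ζ] {Z : Ω → ζ} (hZ : ∀ z, MeasurableSet (Z ⁻¹' {z})) (f : ζ → ℝ) :
    Integrable (fun ω => f (Z ω)) ℙ ∧
      ∫ ω, f (Z ω) ∂ℙ = ∑ z, ℙ.real (Z ⁻¹' {z}) * f z := by
  let _ : MeasurableSpace ζ := ⊤
  have hm : Measurable Z := measurable_to_countable' hZ
  have hi : Integrable f (ℙ.map Z) := Integrable.of_finite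
  refine ⟨hi.comp_measurable hm, ?_⟩
  rw [← integral_map hm.aemeasurable hi.aestronglyMeasurable, integral_fintype hi]
  refine Finset.sum_congr rfl fun z _ => ?_
  rw [map_measureReal_apply hm (measurableSet_singleton z), smul_eq_mul]

lemma vecMul_pow_of_isStationary {P : Matrix S S ℝ} {p : S → ℝ} (hp : IsStationary P p) (k : ℕ) :
    Matrix.vecMul p (P ^ k) = p := by
  induction k with
  | zero => simp
  | succ k ih => rw [pow_succ, ← Matrix.vecMul_vecMul, ih, hp.2]

/-! ### The Markov property and geometric mixing along the trajectory -/

section Trajectory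

variable [MeasurableSpace Ω] {M : MDP S A} {μ : S → A → ℝ} {p : S → ℝ} {ℙ : Measure Ω}
  {s : ℕ → Ω → S} {a : ℕ → Ω → A}

/-- The expected value of `g` over the action and the next state, from the state `x`. -/
def stepMean (M : MDP S A) (μ : S → A → ℝ) (x : S) (g : A → S → ℝ) : ℝ :=
  ∑ c, ∑ y, μ x c * M.trans x c y * g c y

namespace IsTrajectory

lemma measurableSet_history (h : IsTrajectory M μ p ℙ s a) (t : ℕ)
    (z : (Fin t → S × A) × S) : MeasurableSet (history s a t ⁻¹' {z}) := by
  have : history s a t ⁻¹' {z} =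
      (⋂ i : Fin t, (s i ⁻¹' {(z.1 i).1}) ∩ (a i ⁻¹' {(z.1 i).2})) ∩ s t ⁻¹' {z.2} := by
    ext ω
    simp [history, Prod.ext_iff, funext_iff]
  rw [this]
  exact (MeasurableSet.iInter fun i => (h.measurableSet_state _ _).inter
    (h.measurableSet_action _ _)).inter (h.measurableSet_state _ _)

lemma integrable_of_dependsOnHistory [IsFiniteMeasure ℙ] (h : IsTrajectory M μ p ℙ s a) {t : ℕ}
    {F : Ω → ℝ} (hF : DependsOnHistory s a t F) : Integrable F ℙ := by
  obtain ⟨f, rfl⟩ := (Function.factorsThrough_iff F).1 hF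
  exact (integrable_integral_comp_fintype (h.measurableSet_history t) f).1

/-- Compare the cylinder laws at `t + 1` and `t`: after overwriting the state at `t + 1` and the
action at `t`, the products differ only in the last factor. -/
lemma measureReal_cylinder_step (h : IsTrajectory M μ p ℙ s a) (t : ℕ) (x : ℕ → S) (b : ℕ → A)
    (c : A) (y : S) :
    ℙ.real {ω | ((∀ i < t, s i ω = x i ∧ a i ω = b i) ∧ s t ω = x t) ∧ a t ω = c ∧
        s (t + 1) ω = y} =
      ℙ.real {ω | (∀ i < t, s i ω = x i ∧ a i ω = b i) ∧ s t ω = x t} *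
        (μ (x t) c * M.trans (x t) c y) := by
  classical
  have key := h.law (t + 1) (Function.update x (t + 1) y) (Function.update b t c)
  have hx : ∀ i ≤ t, Function.update x (t + 1) y i = x i := fun i hi =>
    Function.update_of_ne (by omega) _ _
  have hb : ∀ i < t, Function.update b t c i = b i := fun i hi =>
    Function.update_of_ne (by omega) _ _
  rw [Finset.prod_range_succ, hx 0 (Nat.zero_le _), hx t le_rfl, Function.update_self,
    Function.update_self, Finset.prod_congr rfl (g := fun i => μ (x i) (b i) *
      M.trans (x i) (b i) (x (i + 1))), ← mul_assoc, ← h.law t x b] at key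
  · rw [← key]
    congr 1
    ext ω
    simp only [Set.mem_ofPred_eq]
    constructor
    · rintro ⟨⟨h1, h2⟩, h3, h4⟩
      refine ⟨fun i hi => ?_, h4⟩
      rcases Nat.lt_succ_iff_lt_or_eq.1 hi with hi' | rfl
      · rw [hx i hi'.le, hb i hi']
        exact h1 i hi'
      · rw [hx i le_rfl, Function.update_self]
        exact ⟨h2, h3⟩
    · rintro ⟨h1, h4⟩
      refine ⟨⟨fun i hi => ?_, ?_⟩, ?_, h4⟩
      · have := h1 i (by omega)
        rwa [hx i hi.le, hb i hi] at this
      · have := (h1 t (by omega)).1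
        rwa [hx t le_rfl] at this
      · have := (h1 t (by omega)).2
        rwa [Function.update_self] at this
  · intro i hi
    have hi := Finset.mem_range.1 hi
    rw [hx i hi.le, hb i hi, hx (i + 1) hi]

/-- The Markov property: given the history up to time `t`, the action and the next state are drawn
from the policy and the transition probabilities. -/
lemma integral_step [IsProbabilityMeasure ℙ] (h : IsTrajectory M μ p ℙ s a) {t : ℕ} {β : Type*}
    {X : Ω → β} (hX : DependsOnHistory s a t X) (g : β → A → S → ℝ) :
    ∫ ω, g (X ω) (a t ω) (s (t + 1) ω) ∂ℙ = ∫ ω, stepMean M μ (s t ω) (g (X ω)) ∂ℙ := by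
  have : Nonempty β := (nonempty_of_isProbabilityMeasure ℙ).map X
  obtain ⟨ξ, rfl⟩ := (Function.factorsThrough_iff X).1 hX
  have hZ : ∀ z : ((Fin t → S × A) × S) × A × S, MeasurableSet
      ((fun ω => (history s a t ω, a t ω, s (t + 1) ω)) ⁻¹' {z}) := by
    intro z
    convert (h.measurableSet_history t z.1).inter
      ((h.measurableSet_action t z.2.1).inter (h.measurableSet_state (t + 1) z.2.2)) using 1
    ext ω
    simp [Prod.ext_iff]
  have h1 := (integrable_integral_comp_fintype (ℙ := ℙ) hZ
    (fun z => g (ξ z.1) z.2.1 z.2.2)).2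
  have h2 := (integrable_integral_comp_fintype (ℙ := ℙ) (h.measurableSet_history t)
    (fun z => stepMean M μ z.2 (g (ξ z)))).2
  refine h1.trans (Eq.trans ?_ h2.symm)
  simp only [Fintype.sum_prod_type (f := fun z : ((Fin t → S × A) × S) × A × S => _),
    Fintype.sum_prod_type (f := fun z : A × S => _)]
  refine Finset.sum_congr rfl fun z _ => ?_
  simp only [stepMean, Finset.mul_sum]
  refine Finset.sum_congr rfl fun c _ => Finset.sum_congr rfl fun y _ => ?_
  have hmul : ℙ.real ((fun ω => (history s a t ω, a t ω, s (t + 1) ω)) ⁻¹' {(z, c, y)}) =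
      ℙ.real (history s a t ⁻¹' {z}) * (μ z.2 c * M.trans z.2 c y) := by
    -- The law is stated for infinite sequences: an attained history is extended by the path of a
    -- sample point `ω₀`, and an unattained one contributes zero to both sides.
    rcases (history s a t ⁻¹' {z}).eq_empty_or_nonempty with he | ⟨ω₀, rfl⟩
    · rw [he, measureReal_empty, zero_mul]
      rw [show (fun ω => (history s a t ω, a t ω, s (t + 1) ω)) ⁻¹' {(z, c, y)} = ∅ from
        Set.subset_empty_iff.1 fun ω hω => he.subset (congrArg Prod.fst hω), measureReal_empty]
    · have := h.measureReal_cylinder_step t (fun i => s i ω₀) (fun i => a i ω₀) c y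
      refine Eq.trans ?_ (this.trans (congrArg (· * _) ?_))
      · congr 1
        ext ω
        simp only [Set.mem_preimage, Set.mem_singleton_iff, Prod.mk.injEq, history_eq_iff,
          Set.mem_ofPred_eq]
      · congr 1
        ext ω
        simp only [Set.mem_preimage, Set.mem_singleton_iff, history_eq_iff, Set.mem_ofPred_eq]
  rw [hmul]
  ring

/-- Averaging out the last transition replaces `w` by its image under the transition matrix; hence
the induction is over all `w`. -/
lemma integral_state_lag [IsProbabilityMeasure ℙ] (h : IsTrajectory M μ p ℙ s a) {t : ℕ}
    {β : Type*} {X : Ω → β} (hX : DependsOnHistory s a t X) (k : ℕ) (w : β → S → ℝ) :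
    ∫ ω, w (X ω) (s (t + k) ω) ∂ℙ =
      ∫ ω, ∑ y, (transMatrix M μ ^ k) (s t ω) y * w (X ω) y ∂ℙ := by
  induction k generalizing w with
  | zero => simp [Matrix.one_apply]
  | succ k ih =>
    have h1 := h.integral_step (hX.mono (Nat.le_add_right t k)) (fun β _ y => w β y)
    have h2 := ih (fun β z => ∑ y, transMatrix M μ z y * w β y)
    rw [← add_assoc, h1]
    refine Eq.trans ?_ (h2.trans ?_)
    · congr 1
      ext ω
      simp only [stepMean, transMatrix, Matrix.of_apply, Finset.sum_mul]
      exact Finset.sum_comm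
    · congr 1
      ext ω
      simp only [pow_succ, Matrix.mul_apply, Finset.mul_sum, Finset.sum_mul]
      rw [Finset.sum_comm]
      simp only [mul_assoc]

lemma integral_transition_lag [IsProbabilityMeasure ℙ] (h : IsTrajectory M μ p ℙ s a) {t : ℕ}
    {β : Type*} {X : Ω → β} (hX : DependsOnHistory s a t X) (k : ℕ) (g : β → S → A → S → ℝ) :
    ∫ ω, g (X ω) (s (t + k) ω) (a (t + k) ω) (s (t + k + 1) ω) ∂ℙ =
      ∫ ω, ∑ z, (transMatrix M μ ^ k) (s t ω) z * stepMean M μ z (g (X ω) z) ∂ℙ := by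
  rw [h.integral_step (((hX.mono (Nat.le_add_right t k)).comp₂ DependsOnHistory.state Prod.mk))
    (fun q => g q.1 q.2)]
  exact h.integral_state_lag hX k (fun β z => stepMean M μ z (g β z))

end IsTrajectory

lemma abs_stepMean_le (hμ : IsPolicy μ) (x : S) {g : A → S → ℝ} {B : ℝ}
    (hg : ∀ c y, |g c y| ≤ B) : |stepMean M μ x g| ≤ B := by
  calc |stepMean M μ x g| ≤ ∑ c, ∑ y, |μ x c * M.trans x c y * g c y| :=
        (Finset.abs_sum_le_sum_abs _ _).trans
          (Finset.sum_le_sum fun c _ => Finset.abs_sum_le_sum_abs _ _)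
    _ ≤ ∑ c, ∑ y, μ x c * (M.trans x c y * B) := by
        refine Finset.sum_le_sum fun c _ => Finset.sum_le_sum fun y _ => ?_
        have h1 := (hμ x).1 c
        have h2 := (M.trans_mem x c).1 y
        rw [abs_mul, abs_of_nonneg (mul_nonneg h1 h2), mul_assoc]
        gcongr
        exact hg c y
    _ = B := by
        simp_rw [← Finset.mul_sum, ← Finset.sum_mul, (M.trans_mem x _).2, one_mul,
          ← Finset.sum_mul, (hμ x).2, one_mul]

lemma stepMean_const (hμ : IsPolicy μ) (x : S) (B : ℝ) : stepMean M μ x (fun _ _ => B) = B := by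
  simp_rw [stepMean, mul_assoc, ← Finset.mul_sum, ← Finset.sum_mul, (M.trans_mem x _).2, one_mul,
    ← Finset.sum_mul, (hμ x).2, one_mul]

/-- The stationary expectation of a function of a transition. -/
def transitionMean (M : MDP S A) (μ : S → A → ℝ) (p : S → ℝ) (g : S → A → S → ℝ) : ℝ :=
  ∑ x, p x * stepMean M μ x (g x)

/-- The factor `2` appears because the total variation distance is half the `ℓ¹` distance. -/
lemma abs_sum_pow_sub_le {P : Matrix S S ℝ} {m ρ B : ℝ} (hmix : MixesGeometrically P p m ρ)
    (hB : 0 ≤ B) (k : ℕ) (x : S) {w : S → ℝ} (hw : ∀ z, |w z| ≤ B) :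
    |∑ z, (P ^ k) x z * w z - ∑ z, p z * w z| ≤ 2 * (m * ρ ^ k) * B := by
  rw [← Finset.sum_sub_distrib]
  calc |∑ z, ((P ^ k) x z * w z - p z * w z)| ≤ ∑ z, |(P ^ k) x z * w z - p z * w z| :=
        Finset.abs_sum_le_sum_abs _ _
    _ ≤ ∑ z, |(P ^ k) x z - p z| * B := by
        refine Finset.sum_le_sum fun z _ => ?_
        rw [← sub_mul, abs_mul]
        gcongr
        exact hw z
    _ = 2 * tvDist ((P ^ k) x) p * B := by
        rw [← Finset.sum_mul, tvDist]
        ring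
    _ ≤ 2 * (m * ρ ^ k) * B := by
        gcongr
        exact hmix k x

namespace IsTrajectory

/-- Decoupling: `X` is fixed by time `t`, and a transition `k` steps later behaves, up to the mixing
error, like a stationary one independent of `X`. It serves both the TD noise and the reward
covariances. -/
lemma abs_integral_transition_sub_le [IsProbabilityMeasure ℙ] (h : IsTrajectory M μ p ℙ s a)
    (hμ : IsPolicy μ) {m ρ B : ℝ} (hmix : MixesGeometrically (transMatrix M μ) p m ρ)
    {t : ℕ} {β : Type*} {X : Ω → β} (hX : DependsOnHistory s a t X) (k : ℕ)
    {g : β → S → A → S → ℝ} (hg : ∀ ω x c y, |g (X ω) x c y| ≤ B) :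
    |∫ ω, g (X ω) (s (t + k) ω) (a (t + k) ω) (s (t + k + 1) ω) ∂ℙ -
      ∫ ω, transitionMean M μ p (g (X ω)) ∂ℙ| ≤ 2 * (m * ρ ^ k) * B := by
  obtain ⟨ω₀⟩ := nonempty_of_isProbabilityMeasure ℙ
  have hB : 0 ≤ B := (abs_nonneg _).trans (hg ω₀ (s 0 ω₀) (a 0 ω₀) (s 0 ω₀))
  rw [h.integral_transition_lag hX, ← integral_sub]
  · have hb := norm_integral_le_of_norm_le_const (μ := ℙ) (C := 2 * (m * ρ ^ k) * B)
      (f := fun ω => ∑ z, (transMatrix M μ ^ k) (s t ω) z * stepMean M μ z (g (X ω) z) -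
        transitionMean M μ p (g (X ω))) (Filter.Eventually.of_forall fun ω =>
          abs_sum_pow_sub_le hmix hB k _ fun z => abs_stepMean_le hμ z (hg ω z))
    simpa using hb
  · exact h.integrable_of_dependsOnHistory (hX.comp₂ DependsOnHistory.state
      fun q x => ∑ z, (transMatrix M μ ^ k) x z * stepMean M μ z (g q z))
  · exact h.integrable_of_dependsOnHistory (hX.comp fun q => transitionMean M μ p (g q))

lemma measureReal_initial (h : IsTrajectory M μ p ℙ s a) (hA : Nonempty A) (x : S) :
    ℙ.real (s 0 ⁻¹' {x}) = p x := by
  obtain ⟨b⟩ := hA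
  have := h.law 0 (fun _ => x) (fun _ => b)
  simp only [not_lt_zero, IsEmpty.forall_iff, implies_true, true_and,
    Finset.range_zero, Finset.prod_empty, mul_one] at this
  exact this

lemma integral_transition [IsProbabilityMeasure ℙ] (h : IsTrajectory M μ p ℙ s a)
    (hp : IsStationary (transMatrix M μ) p) (t : ℕ) (g : S → A → S → ℝ) :
    ∫ ω, g (s t ω) (a t ω) (s (t + 1) ω) ∂ℙ = transitionMean M μ p g := by
  obtain ⟨ω₀⟩ := nonempty_of_isProbabilityMeasure ℙ
  have h1 := h.integral_transition_lag (t := 0) (DependsOnHistory.const ()) t (fun _ => g)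
  simp only [zero_add] at h1
  rw [h1, (integrable_integral_comp_fintype (h.measurableSet_state 0) (fun x =>
    ∑ z, (transMatrix M μ ^ t) x z * stepMean M μ z (g z))).2, transitionMean]
  simp_rw [h.measureReal_initial ⟨a 0 ω₀⟩, Finset.mul_sum]
  rw [Finset.sum_comm]
  refine Finset.sum_congr rfl fun z _ => ?_
  conv_rhs => rw [← vecMul_pow_of_isStationary hp t]
  simp [Matrix.vecMul, dotProduct, Finset.sum_mul, mul_assoc]

end IsTrajectory

end Trajectory

/-! ### The Poincaré inequality through the additive reversibilization -/

section SpectralGap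

variable {S : Type*} [Fintype S] [DecidableEq S]

/-- The variance of `v` under the distribution `p`. -/
def variance (p v : S → ℝ) : ℝ := normSqD p (fun x => v x - mean p v)

/-- The Dirichlet form `⟪v, v - P v⟫` of the matrix `P`, weighted by `p`. -/
def dirichletForm (P : Matrix S S ℝ) (p v : S → ℝ) : ℝ :=
  ∑ x, p x * v x * (v x - ∑ y, P x y * v y)

/-- A stochastic matrix together with a stationary distribution. -/
structure IsStationaryChain (P : Matrix S S ℝ) (p : S → ℝ) : Prop where
  nonneg : ∀ x y, 0 ≤ P x y
  row_sum : ∀ x, ∑ y, P x y = 1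
  stationary : IsStationary P p

namespace IsStationaryChain

variable {P : Matrix S S ℝ} {p : S → ℝ}

lemma col_sum (h : IsStationaryChain P p) (y : S) : ∑ x, p x * P x y = p y :=
  congrFun h.stationary.2 y

/-- Some state `x` carries mass, some power of `P` leads from `x` to `y`, and `p` is invariant under
that power. -/
lemma pos (h : IsStationaryChain P p) (hirr : P.IsIrreducible) (y : S) : 0 < p y := by
  obtain ⟨x, hx⟩ : ∃ x, 0 < p x := by
    by_contra! hneg
    have := Finset.sum_nonpos fun x (_ : x ∈ Finset.univ) => hneg x
    rw [h.stationary.1.2] at this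
    linarith
  obtain ⟨k, -, hk⟩ := (Matrix.isIrreducible_iff_exists_pow_pos h.nonneg).1 hirr x y
  have h1 : ∑ z, p z * (P ^ k) z y = p y := congrFun (vecMul_pow_of_isStationary h.stationary k) y
  rw [← h1]
  exact (mul_pos hx hk).trans_le (Finset.single_le_sum (f := fun z => p z * (P ^ k) z y)
    (fun z _ => mul_nonneg (h.stationary.1.1 z) (Matrix.pow_apply_nonneg h.nonneg k z y))
    (Finset.mem_univ x))

/-- Expand the square: row sums and stationarity turn both square terms into `‖v‖_D²`. Reversibility
plays no role. -/
lemma two_mul_dirichletForm (h : IsStationaryChain P p) (v : S → ℝ) :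
    2 * dirichletForm P p v = ∑ x, ∑ y, p x * P x y * (v x - v y) ^ 2 := by
  have h1 : ∑ x, ∑ y, p x * P x y * v x ^ 2 = ∑ x, p x * v x ^ 2 := by
    refine Finset.sum_congr rfl fun x _ => ?_
    rw [← Finset.sum_mul, ← Finset.mul_sum, h.row_sum, mul_one]
  have h2 : ∑ x, ∑ y, p x * P x y * v y ^ 2 = ∑ x, p x * v x ^ 2 := by
    rw [Finset.sum_comm]
    refine Finset.sum_congr rfl fun y _ => ?_
    rw [← Finset.sum_mul, h.col_sum]
  have h3 : ∑ x, ∑ y, p x * P x y * (v x - v y) ^ 2 = ∑ x, ∑ y, p x * P x y * v x ^ 2 +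
      ∑ x, ∑ y, p x * P x y * v y ^ 2 - 2 * ∑ x, ∑ y, p x * v x * (P x y * v y) := by
    simp only [Finset.mul_sum, ← Finset.sum_add_distrib, ← Finset.sum_sub_distrib]
    exact Finset.sum_congr rfl fun x _ => Finset.sum_congr rfl fun y _ => by ring
  rw [h3, h1, h2, dirichletForm]
  simp only [mul_sub, Finset.sum_sub_distrib, ← Finset.mul_sum]
  simp only [mul_assoc, ← sq]
  ring

lemma dirichletForm_nonneg (h : IsStationaryChain P p) (v : S → ℝ) : 0 ≤ dirichletForm P p v := by
  have : 0 ≤ 2 * dirichletForm P p v := by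
    rw [h.two_mul_dirichletForm]
    exact Finset.sum_nonneg fun x _ => Finset.sum_nonneg fun y _ =>
      mul_nonneg (mul_nonneg (h.stationary.1.1 x) (h.nonneg x y)) (sq_nonneg _)
  linarith

lemma dirichletForm_le (h : IsStationaryChain P p) (v : S → ℝ) :
    dirichletForm P p v ≤ 2 * normSqD p v := by
  have h1 : ∑ x, ∑ y, p x * P x y * v x ^ 2 = normSqD p v := by
    refine Finset.sum_congr rfl fun x _ => ?_
    rw [← Finset.sum_mul, ← Finset.mul_sum, h.row_sum, mul_one]
  have h2 : ∑ x, ∑ y, p x * P x y * v y ^ 2 = normSqD p v := by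
    rw [Finset.sum_comm]
    refine Finset.sum_congr rfl fun y _ => ?_
    rw [← Finset.sum_mul, h.col_sum]
  have : 2 * dirichletForm P p v ≤ 2 * normSqD p v + 2 * normSqD p v := by
    rw [h.two_mul_dirichletForm]
    nth_rw 1 [← h1]
    rw [← h2]
    simp only [Finset.mul_sum, ← Finset.sum_add_distrib]
    refine Finset.sum_le_sum fun x _ => Finset.sum_le_sum fun y _ => ?_
    nlinarith [mul_nonneg (mul_nonneg (h.stationary.1.1 x) (h.nonneg x y))
      (sq_nonneg (v x + v y))]
  linarith

/-- A vanishing sum of squares forces `v` to agree across every edge, hence along every path, and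
irreducibility joins any two states. -/
lemma eq_of_dirichletForm_nonpos (h : IsStationaryChain P p) (hirr : P.IsIrreducible)
    {v : S → ℝ} (hv : dirichletForm P p v ≤ 0) (x y : S) : v x = v y := by
  have h0 : ∑ x, ∑ y, p x * P x y * (v x - v y) ^ 2 = 0 := by
    rw [← h.two_mul_dirichletForm, hv.antisymm (h.dirichletForm_nonneg v), mul_zero]
  have hnn : ∀ x y, 0 ≤ p x * P x y * (v x - v y) ^ 2 := fun x y =>
    mul_nonneg (mul_nonneg (h.stationary.1.1 x) (h.nonneg x y)) (sq_nonneg _)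
  have hstep : ∀ x y, 0 < P x y → v x = v y := by
    intro x y hxy
    have h1 := (Finset.sum_eq_zero_iff_of_nonneg fun x _ =>
      Finset.sum_nonneg fun y _ => hnn x y).1 h0 x (Finset.mem_univ x)
    have h2 := (Finset.sum_eq_zero_iff_of_nonneg fun y _ => hnn x y).1 h1 y (Finset.mem_univ y)
    have h3 := (mul_pos (h.pos hirr x) hxy).ne'
    exact sub_eq_zero.1 (pow_eq_zero_iff (two_ne_zero)|>.1 ((mul_eq_zero.1 h2).resolve_left h3))
  have hpow : ∀ k x y, 0 < (P ^ k) x y → v x = v y := by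
    intro k
    induction k with
    | zero =>
      intro x y hxy
      by_contra hne
      have : x ≠ y := fun e => hne (congrArg v e)
      simp [this] at hxy
    | succ k ih =>
      intro x y hxy
      rw [pow_succ, Matrix.mul_apply] at hxy
      obtain ⟨z, -, hz⟩ := Finset.exists_lt_of_sum_lt (f := fun _ => (0 : ℝ)) (by simpa using hxy)
      have h1 := Matrix.pow_apply_nonneg h.nonneg k x z
      have h2 := h.nonneg z y
      exact (ih x z (pos_of_mul_pos_left hz h2)).trans (hstep z y (pos_of_mul_pos_right hz h1))
  obtain ⟨k, -, hk⟩ := (Matrix.isIrreducible_iff_exists_pow_pos h.nonneg).1 hirr x y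
  exact hpow k x y hk

end IsStationaryChain

/-- The symmetric matrix similar to the additive reversibilization of `P`. -/
noncomputable def symmetrization (P : Matrix S S ℝ) (p : S → ℝ) : Matrix S S ℝ :=
  Matrix.of fun i j => √(p i) * additiveReversibilization P p i j / √(p j)

lemma isHermitian_symmetrization {P : Matrix S S ℝ} {p : S → ℝ} (hp : ∀ x, 0 < p x) :
    (symmetrization P p).IsHermitian := by
  refine Matrix.IsHermitian.ext fun i j => ?_
  simp only [symmetrization, additiveReversibilization, Matrix.of_apply, star_trivial]
  have hi := Real.sqrt_pos.2 (hp i)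
  have hj := Real.sqrt_pos.2 (hp j)
  rw [← Real.mul_self_sqrt (hp i).le, ← Real.mul_self_sqrt (hp j).le,
    Real.sqrt_mul_self hi.le, Real.sqrt_mul_self hj.le]
  field_simp
  ring

/-- Conjugation by `diag √p`. It makes the spectral theorem for Hermitian matrices available for the
eigenvalues of the reversibilization. -/
lemma charpoly_symmetrization {P : Matrix S S ℝ} {p : S → ℝ} (hp : ∀ x, 0 < p x) :
    (symmetrization P p).charpoly = (additiveReversibilization P p).charpoly := by
  have hne : ∀ x, √(p x) ≠ 0 := fun x => (Real.sqrt_pos.2 (hp x)).ne'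
  let D : (Matrix S S ℝ)ˣ := ⟨Matrix.diagonal fun x => √(p x), Matrix.diagonal fun x => (√(p x))⁻¹,
    by simp [hne], by simp [hne]⟩
  rw [← Matrix.charpoly_units_conj D (additiveReversibilization P p)]
  congr 1
  ext i j
  rw [← Matrix.coe_units_inv]
  change _ = ((Matrix.diagonal fun x => √(p x)) * additiveReversibilization P p *
    Matrix.diagonal fun x => (√(p x))⁻¹) i j
  simp [symmetrization, div_eq_mul_inv]

lemma dotProduct_mulVec_eq_sum_eigenvalues {N : Matrix S S ℝ} (hN : N.IsHermitian) (w : S → ℝ) :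
    w ⬝ᵥ N.mulVec w = ∑ i, hN.eigenvalues i * (⇑(hN.eigenvectorBasis i) ⬝ᵥ w) ^ 2 := by
  have h1 := hN.eigenvectorBasis.sum_inner_mul_inner (WithLp.toLp 2 w) (WithLp.toLp 2 (N.mulVec w))
  simp only [EuclideanSpace.inner_eq_star_dotProduct, star_trivial] at h1
  rw [dotProduct_comm, ← h1]
  refine Finset.sum_congr rfl fun i _ => ?_
  rw [dotProduct_comm (N.mulVec w), Matrix.dotProduct_mulVec, ← Matrix.mulVec_transpose,
    show N.transpose = N from hN, hN.mulVec_eigenvectorBasis, smul_dotProduct, smul_eq_mul]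
  ring

lemma dotProduct_self_eq_sum {N : Matrix S S ℝ} (hN : N.IsHermitian) (w : S → ℝ) :
    w ⬝ᵥ w = ∑ i, (⇑(hN.eigenvectorBasis i) ⬝ᵥ w) ^ 2 := by
  have h1 := hN.eigenvectorBasis.sum_inner_mul_inner (WithLp.toLp 2 w) (WithLp.toLp 2 w)
  simp only [EuclideanSpace.inner_eq_star_dotProduct, star_trivial] at h1
  rw [← h1]
  refine Finset.sum_congr rfl fun i _ => ?_
  rw [dotProduct_comm w, sq]

lemma dotProduct_eigenvectorBasis_self {N : Matrix S S ℝ} (hN : N.IsHermitian) (i : S) :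
    ⇑(hN.eigenvectorBasis i) ⬝ᵥ ⇑(hN.eigenvectorBasis i) = 1 := by
  have := hN.eigenvectorBasis.inner_eq_one i
  simpa only [EuclideanSpace.inner_eq_star_dotProduct, star_trivial] using this

lemma dotProduct_eigenvectorBasis_of_ne {N : Matrix S S ℝ} (hN : N.IsHermitian) {i j : S}
    (hij : i ≠ j) : ⇑(hN.eigenvectorBasis i) ⬝ᵥ ⇑(hN.eigenvectorBasis j) = 0 := by
  have := hN.eigenvectorBasis.inner_eq_zero hij.symm
  simpa only [EuclideanSpace.inner_eq_star_dotProduct, star_trivial] using this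

/-- Translates the sorted list of roots into an eigenbasis: `i₀` indexes a top eigenvector and `i₁`
the next one, with multiplicity. -/
lemma exists_eigenvalues_le_secondEigenvalue {Q N : Matrix S S ℝ} (hN : N.IsHermitian)
    (hQ : N.charpoly = Q.charpoly) (hcard : 2 ≤ Fintype.card S) :
    ∃ i₀ i₁ : S, i₀ ≠ i₁ ∧ secondEigenvalue Q = hN.eigenvalues i₁ ∧
      hN.eigenvalues i₁ ≤ hN.eigenvalues i₀ ∧
      ∀ i, i ≠ i₀ → hN.eigenvalues i ≤ hN.eigenvalues i₁ := by
  -- The equivalence that underlies the indexing of `eigenvalues` by `S`, which makes `he`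
  -- definitional.
  let e : Fin (Fintype.card S) ≃ S := Fintype.equivOfCardEq (Fintype.card_fin _)
  have he : ∀ i, hN.eigenvalues i = hN.eigenvalues₀ (e.symm i) := fun i => rfl
  refine ⟨e ⟨0, by omega⟩, e ⟨1, by omega⟩, fun h => ?_, ?_, ?_, fun i hi => ?_⟩
  · simpa using e.injective h
  · have h1 := hN.sort_roots_charpoly_eq_eigenvalues₀
    simp only [RCLike.re_to_real, Multiset.map_id'] at h1
    rw [secondEigenvalue, ← hQ, h1, he, e.symm_apply_apply, List.getD_eq_getElem _ _ (by simpa)]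
    simp
  · rw [he, he]
    exact hN.eigenvalues₀_antitone (by simp)
  · rw [he, he]
    refine hN.eigenvalues₀_antitone ?_
    rw [e.symm_apply_apply, Fin.le_def]
    by_contra hlt
    exact hi (by rw [← e.symm_apply_eq]; ext; simpa using hlt)

namespace IsStationaryChain

variable {P : Matrix S S ℝ} {p : S → ℝ}

/-- Substituting `w = √p · v` turns Euclidean products into `D`-weighted ones, and `P` and its
adjoint `P*` have the same quadratic form. -/
lemma dotProduct_symmetrization_mulVec (hp : ∀ x, 0 < p x)
    (w : S → ℝ) :
    w ⬝ᵥ w - w ⬝ᵥ (symmetrization P p).mulVec w = dirichletForm P p (fun x => w x / √(p x)) := by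
  have hne : ∀ x, √(p x) ≠ 0 := fun x => (Real.sqrt_pos.2 (hp x)).ne'
  obtain ⟨v, rfl⟩ : ∃ v : S → ℝ, w = fun x => √(p x) * v x :=
    ⟨fun x => w x / √(p x), funext fun x => by field_simp [hne x]⟩
  have hv : (fun x => √(p x) * v x / √(p x)) = v := funext fun x => by field_simp [hne x]
  have h1 : (fun x => √(p x) * v x) ⬝ᵥ (symmetrization P p).mulVec (fun x => √(p x) * v x) =
      ∑ x, ∑ y, p x * v x * (P x y * v y) := by
    have h2 : ∑ x, ∑ y, p y * v y * (P y x * v x) = ∑ x, ∑ y, p x * v x * (P x y * v y) :=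
      Finset.sum_comm
    have h3 : (fun x => √(p x) * v x) ⬝ᵥ (symmetrization P p).mulVec (fun x => √(p x) * v x) =
        (∑ x, ∑ y, p x * v x * (P x y * v y) + ∑ x, ∑ y, p y * v y * (P y x * v x)) / 2 := by
      simp only [dotProduct, Matrix.mulVec, Finset.mul_sum, ← Finset.sum_add_distrib,
        Finset.sum_div]
      refine Finset.sum_congr rfl fun x _ => Finset.sum_congr rfl fun y _ => ?_
      simp only [symmetrization, additiveReversibilization, Matrix.of_apply]
      have hx := hne x
      have hy := hne y
      have hx' := (hp x).ne'
      calc _ = (√(p x) * √(p x)) * v x * v y * (P x y + p y / p x * P y x) / 2 := by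
            field_simp
        _ = _ := by
            rw [Real.mul_self_sqrt (hp x).le]
            field_simp
    rw [h3, h2]
    ring
  rw [h1, hv, dirichletForm]
  simp only [dotProduct, mul_sub, Finset.sum_sub_distrib, Finset.mul_sum]
  congr 1
  refine Finset.sum_congr rfl fun x _ => ?_
  calc _ = (√(p x) * √(p x)) * v x * v x := by ring
    _ = _ := by rw [Real.mul_self_sqrt (hp x).le]

lemma symmetrization_mulVec_sqrt (h : IsStationaryChain P p) (hp : ∀ x, 0 < p x) :
    (symmetrization P p).mulVec (fun x => √(p x)) = fun x => √(p x) := by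
  ext x
  have hx := (hp x).ne'
  have h1 : ∀ y, symmetrization P p x y * √(p y) =
      √(p x) / 2 * P x y + √(p x) / (2 * p x) * (p y * P y x) := by
    intro y
    have hy := (Real.sqrt_pos.2 (hp y)).ne'
    simp only [symmetrization, additiveReversibilization, Matrix.of_apply]
    field_simp
  simp only [Matrix.mulVec, dotProduct, h1, Finset.sum_add_distrib, ← Finset.mul_sum, h.row_sum,
    h.col_sum]
  field_simp
  ring

lemma one_sub_eigenvalues (hp : ∀ x, 0 < p x)
    (hN : (symmetrization P p).IsHermitian) (i : S) :
    1 - hN.eigenvalues i = dirichletForm P p (fun x => hN.eigenvectorBasis i x / √(p x)) := by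
  rw [← dotProduct_symmetrization_mulVec hp, hN.mulVec_eigenvectorBasis, dotProduct_smul,
    dotProduct_eigenvectorBasis_self, smul_eq_mul, mul_one]

/-- Otherwise both leading eigenvectors have nonpositive Dirichlet form after division by `√p`, so
both are nonzero multiples of `√p`, against their orthogonality. -/
lemma secondEigenvalue_lt_one (h : IsStationaryChain P p) (hirr : P.IsIrreducible)
    (hcard : 2 ≤ Fintype.card S) :
    secondEigenvalue (additiveReversibilization P p) < 1 := by
  have hp := h.pos hirr
  have hN := isHermitian_symmetrization (P := P) hp
  obtain ⟨i₀, i₁, hne, heq, hle, -⟩ := exists_eigenvalues_le_secondEigenvalue hN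
    (charpoly_symmetrization hp) hcard
  rw [heq]
  by_contra! hge
  have hconst : ∀ i, 1 ≤ hN.eigenvalues i →
      ∃ c : ℝ, c ≠ 0 ∧ ⇑(hN.eigenvectorBasis i) = c • fun x => √(p x) := by
    intro i hi
    have h1 := h.eq_of_dirichletForm_nonpos hirr (v := fun x => hN.eigenvectorBasis i x / √(p x))
      (by rw [← one_sub_eigenvalues hp hN]; linarith)
    have h2 : ⇑(hN.eigenvectorBasis i) =
        (hN.eigenvectorBasis i i₀ / √(p i₀)) • fun x => √(p x) := by
      ext x
      have hx := (Real.sqrt_pos.2 (hp x)).ne'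
      rw [Pi.smul_apply, smul_eq_mul, h1 i₀ x]
      field_simp
    refine ⟨_, fun h0 => ?_, h2⟩
    have h3 := dotProduct_eigenvectorBasis_self hN i
    rw [h2, h0] at h3
    simp at h3
  obtain ⟨c, hc, h0⟩ := hconst i₀ (hge.trans hle)
  obtain ⟨d, hd, h1⟩ := hconst i₁ hge
  have horth := dotProduct_eigenvectorBasis_of_ne hN hne
  rw [h0, h1, smul_dotProduct, dotProduct_smul, smul_eq_mul, smul_eq_mul] at horth
  have hpos : 0 < (fun x => √(p x)) ⬝ᵥ fun x => √(p x) := by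
    have : (fun x => √(p x)) ⬝ᵥ (fun x => √(p x)) = 1 := by
      simp only [dotProduct, Real.mul_self_sqrt (hp _).le, h.stationary.1.2]
    rw [this]
    exact one_pos
  exact mul_ne_zero hc (mul_ne_zero hd hpos.ne') horth

/-- Needed for a lower bound on the inverse gap, so that the rate factor of the theorem dominates an
absolute constant. -/
lemma neg_one_le_secondEigenvalue (h : IsStationaryChain P p) (hirr : P.IsIrreducible)
    (hcard : 2 ≤ Fintype.card S) :
    -1 ≤ secondEigenvalue (additiveReversibilization P p) := by
  have hp := h.pos hirr
  have hN := isHermitian_symmetrization (P := P) hp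
  obtain ⟨i₀, i₁, -, heq, -, -⟩ := exists_eigenvalues_le_secondEigenvalue hN
    (charpoly_symmetrization hp) hcard
  rw [heq]
  have h1 := h.dirichletForm_le (fun x => hN.eigenvectorBasis i₁ x / √(p x))
  rw [← one_sub_eigenvalues hp hN] at h1
  have h2 : normSqD p (fun x => hN.eigenvectorBasis i₁ x / √(p x)) = 1 := by
    rw [← dotProduct_eigenvectorBasis_self hN i₁]
    refine Finset.sum_congr rfl fun x _ => ?_
    have hx := (hp x).ne'
    rw [div_pow, Real.sq_sqrt (hp x).le]
    field_simp
  linarith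

lemma dirichletForm_sub_const (h : IsStationaryChain P p) (v : S → ℝ) (c : ℝ) :
    dirichletForm P p (fun x => v x - c) = dirichletForm P p v := by
  have := h.two_mul_dirichletForm (fun x => v x - c)
  simp only [sub_sub_sub_cancel_right] at this
  rw [← h.two_mul_dirichletForm] at this
  linarith

/-- The Poincaré inequality for the additive reversibilization. -/
lemma mul_variance_le_dirichletForm (h : IsStationaryChain P p) (hirr : P.IsIrreducible)
    (hcard : 2 ≤ Fintype.card S) (v : S → ℝ) :
    (1 - secondEigenvalue (additiveReversibilization P p)) * variance p v ≤
      dirichletForm P p v := by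
  have hp := h.pos hirr
  have hN := isHermitian_symmetrization (P := P) hp
  obtain ⟨i₀, i₁, hne, heq, hle, hmax⟩ := exists_eigenvalues_le_secondEigenvalue hN
    (charpoly_symmetrization hp) hcard
  have hlt := h.secondEigenvalue_lt_one hirr hcard
  rw [heq] at hlt ⊢
  set u : S → ℝ := fun x => √(p x) with hu
  set w : S → ℝ := fun x => √(p x) * (v x - mean p v) with hw
  have huu : u ⬝ᵥ u = 1 := by
    simp only [hu, dotProduct, Real.mul_self_sqrt (hp _).le, h.stationary.1.2]
  -- `u` is an eigenvector for the eigenvalue `1`, while all indices other than `i₀` have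
  -- eigenvalues below `1`.
  have hu0 : ∀ i, i ≠ i₀ → ⇑(hN.eigenvectorBasis i) ⬝ᵥ u = 0 := by
    intro i hi
    have h1 : hN.eigenvalues i * (⇑(hN.eigenvectorBasis i) ⬝ᵥ u) =
        ⇑(hN.eigenvectorBasis i) ⬝ᵥ u := by
      rw [← smul_eq_mul, ← smul_dotProduct, ← hN.mulVec_eigenvectorBasis]
      conv_rhs => rw [hu, ← h.symmetrization_mulVec_sqrt hp]
      rw [Matrix.dotProduct_mulVec, ← Matrix.mulVec_transpose,
        show (symmetrization P p).transpose = symmetrization P p from hN]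
    have h2 := hmax i hi
    have h3 : (hN.eigenvalues i - 1) * (⇑(hN.eigenvectorBasis i) ⬝ᵥ u) = 0 := by linarith
    exact (mul_eq_zero.1 h3).resolve_left (by linarith)
  have huw : u ⬝ᵥ w = 0 := by
    have : u ⬝ᵥ w = ∑ x, (p x * v x - p x * mean p v) := by
      refine Finset.sum_congr rfl fun x _ => ?_
      simp only [hu, hw]
      rw [← mul_assoc, Real.mul_self_sqrt (hp x).le, mul_sub]
    rw [this, Finset.sum_sub_distrib, ← Finset.sum_mul, h.stationary.1.2, one_mul, mean, sub_self]
  -- By `hu0` only the index `i₀` survives in the expansions of `u ⬝ᵥ w = 0` and `u ⬝ᵥ u = 1`. So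
  -- the centred vector `w` has no component along the top eigenvector.
  have hw0 : ⇑(hN.eigenvectorBasis i₀) ⬝ᵥ w = 0 := by
    have h1 := hN.eigenvectorBasis.sum_inner_mul_inner (WithLp.toLp 2 u) (WithLp.toLp 2 w)
    simp only [EuclideanSpace.inner_eq_star_dotProduct, star_trivial] at h1
    rw [dotProduct_comm w u, huw, Finset.sum_eq_single i₀] at h1
    · have h2 := dotProduct_self_eq_sum hN u
      rw [huu, Finset.sum_eq_single i₀] at h2
      · rcases mul_eq_zero.1 h1 with h3 | h3
        · rw [h3] at h2
          norm_num at h2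
        · rwa [dotProduct_comm]
      · intro i _ hi
        rw [hu0 i hi]
        norm_num
      · simp
    · intro i _ hi
      rw [hu0 i hi, zero_mul]
    · simp
  have hvar : variance p v = w ⬝ᵥ w := by
    refine Finset.sum_congr rfl fun x _ => ?_
    simp only [hw]
    rw [← sq, mul_pow, Real.sq_sqrt (hp x).le]
  have hdir : dirichletForm P p v = w ⬝ᵥ w - w ⬝ᵥ (symmetrization P p).mulVec w := by
    rw [dotProduct_symmetrization_mulVec hp, ← h.dirichletForm_sub_const v (mean p v)]
    congr 1
    ext x
    have hx := (Real.sqrt_pos.2 (hp x)).ne'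
    simp only [hw]
    field_simp
  rw [hvar, hdir, dotProduct_mulVec_eq_sum_eigenvalues hN, dotProduct_self_eq_sum hN w,
    ← Finset.sum_sub_distrib, Finset.mul_sum]
  refine Finset.sum_le_sum fun i _ => ?_
  by_cases hi : i = i₀
  · rw [hi, hw0]
    norm_num
  · nlinarith [hmax i hi, sq_nonneg (⇑(hN.eigenvectorBasis i) ⬝ᵥ w)]

lemma variance_le_invSpectralGap_mul (h : IsStationaryChain P p) (hirr : P.IsIrreducible)
    (v : S → ℝ) : variance p v ≤ invSpectralGap P p * dirichletForm P p v := by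
  rcases le_or_gt 2 (Fintype.card S) with hcard | hcard
  · have h1 := h.secondEigenvalue_lt_one hirr hcard
    have h2 := h.mul_variance_le_dirichletForm hirr hcard v
    rw [invSpectralGap, one_div, ← div_eq_inv_mul, le_div_iff₀ (by linarith)]
    linarith
  · have hsub : Subsingleton S := Fintype.card_le_one_iff_subsingleton.1 (by omega)
    have hv : variance p v = 0 := by
      refine Finset.sum_eq_zero fun x _ => ?_
      have : mean p v = v x := by
        rw [mean, Finset.sum_congr rfl (g := fun y => p y * v x) fun y _ => by
          rw [Subsingleton.elim y x], ← Finset.sum_mul, h.stationary.1.2, one_mul]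
      simp [this]
    have hd : dirichletForm P p v = 0 := by
      have := h.two_mul_dirichletForm v
      rw [Finset.sum_eq_zero fun x _ => Finset.sum_eq_zero fun y _ => by
        rw [Subsingleton.elim y x, sub_self, zero_pow two_ne_zero, mul_zero]] at this
      linarith
    rw [hv, hd, mul_zero]

lemma half_le_invSpectralGap (h : IsStationaryChain P p) (hirr : P.IsIrreducible) :
    1 / 2 ≤ invSpectralGap P p := by
  rcases le_or_gt 2 (Fintype.card S) with hcard | hcard
  · have h1 := h.secondEigenvalue_lt_one hirr hcard
    have h2 := h.neg_one_le_secondEigenvalue hirr hcard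
    exact one_div_le_one_div_of_le (by linarith) (by linarith)
  -- With fewer than two states the list of roots is too short, and the default `0` makes the
  -- inverse gap `1`.
  · have : secondEigenvalue (additiveReversibilization P p) = 0 := by
      rw [secondEigenvalue, List.getD_eq_default]
      rw [Multiset.length_sort]
      have := Polynomial.card_roots' (additiveReversibilization P p).charpoly
      rw [Matrix.charpoly_natDegree_eq_dim] at this
      omega
    rw [invSpectralGap, this]
    norm_num

end IsStationaryChain

end SpectralGap

/-! ### Variance and the `D`-norm -/

section Variance

variable {S : Type*} [Fintype S] {p : S → ℝ}

lemma normSqD_nonneg (hp : p ∈ stdSimplex ℝ S) (v : S → ℝ) : 0 ≤ normSqD p v :=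
  Finset.sum_nonneg fun x _ => mul_nonneg (hp.1 x) (sq_nonneg _)

lemma normSqD_le_of_abs_le (hp : p ∈ stdSimplex ℝ S) {v : S → ℝ} {B : ℝ} (hv : ∀ x, |v x| ≤ B) :
    normSqD p v ≤ B ^ 2 := by
  calc normSqD p v ≤ ∑ x, p x * B ^ 2 := by
        refine Finset.sum_le_sum fun x _ => mul_le_mul_of_nonneg_left ?_ (hp.1 x)
        exact sq_le_sq' (abs_le.1 (hv x)).1 (abs_le.1 (hv x)).2
    _ = B ^ 2 := by rw [← Finset.sum_mul, hp.2, one_mul]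

/-- Pythagoras: centred functions are `D`-orthogonal to constants. -/
lemma normSqD_sub_mean_add (hp : p ∈ stdSimplex ℝ S) (v : S → ℝ) (c : ℝ) :
    normSqD p (fun x => v x - mean p v + c) = variance p v + c ^ 2 := by
  have h1 : ∑ x, p x * (v x - mean p v) = 0 := by
    simp only [mul_sub, Finset.sum_sub_distrib, ← Finset.sum_mul, hp.2, one_mul, mean, sub_self]
  calc normSqD p (fun x => v x - mean p v + c) = variance p v +
        2 * c * ∑ x, p x * (v x - mean p v) + (∑ x, p x) * c ^ 2 := by
        simp only [normSqD, variance, Finset.mul_sum, Finset.sum_mul, ← Finset.sum_add_distrib]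
        exact Finset.sum_congr rfl fun x _ => by ring
    _ = variance p v + c ^ 2 := by rw [h1, hp.2]; ring

lemma variance_le_normSqD (hp : p ∈ stdSimplex ℝ S) (v : S → ℝ) :
    variance p v ≤ normSqD p v := by
  have := normSqD_sub_mean_add hp v (mean p v)
  simp only [sub_add_cancel] at this
  rw [show normSqD p v = normSqD p (fun x => v x) from rfl, this]
  linarith [sq_nonneg (mean p v)]

lemma mean_add (v w : S → ℝ) : mean p (fun x => v x + w x) = mean p v + mean p w := by
  simp only [mean, mul_add, Finset.sum_add_distrib]

lemma variance_add_le (hp : p ∈ stdSimplex ℝ S) (v w : S → ℝ) :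
    variance p (fun x => v x + w x) ≤ 2 * variance p v + 2 * variance p w := by
  simp only [variance, normSqD, mean_add, Finset.mul_sum, ← Finset.sum_add_distrib]
  refine Finset.sum_le_sum fun x _ => ?_
  nlinarith [mul_nonneg (hp.1 x) (sq_nonneg ((v x - mean p v) - (w x - mean p w)))]

lemma variance_average_le (hp : p ∈ stdSimplex ℝ S) (T : ℕ) (v : ℕ → S → ℝ) :
    variance p (fun x => 1 / (T : ℝ) * ∑ t ∈ Finset.range T, v t x) ≤
      1 / (T : ℝ) * ∑ t ∈ Finset.range T, variance p (v t) := by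
  rcases T.eq_zero_or_pos with rfl | hT
  · simp [variance, normSqD, mean]
  have hT' : (0 : ℝ) < T := Nat.cast_pos.2 hT
  have hmean : mean p (fun x => 1 / (T : ℝ) * ∑ t ∈ Finset.range T, v t x) =
      1 / (T : ℝ) * ∑ t ∈ Finset.range T, mean p (v t) := by
    simp only [mean, Finset.mul_sum]
    rw [Finset.sum_comm]
    exact Finset.sum_congr rfl fun t _ => Finset.sum_congr rfl fun x _ => by ring
  simp only [variance, normSqD, hmean]
  rw [Finset.sum_comm, Finset.mul_sum Finset.univ]
  refine Finset.sum_le_sum fun x _ => ?_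
  rw [← Finset.mul_sum, ← mul_sub, ← Finset.sum_sub_distrib, mul_left_comm]
  refine mul_le_mul_of_nonneg_left ?_ (hp.1 x)
  have h : (∑ t ∈ Finset.range T, (v t x - mean p (v t))) ^ 2 ≤
      ((Finset.range T).card : ℝ) * ∑ t ∈ Finset.range T, (v t x - mean p (v t)) ^ 2 :=
    sq_sum_le_card_mul_sum_sq
  rw [Finset.card_range] at h
  rw [mul_pow, one_div, inv_pow, inv_mul_le_iff₀ (by positivity)]
  calc _ ≤ _ := h
    _ = _ := by field_simp

end Variance

/-! ### Projection onto the constraint set -/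

section Projection

variable {κ : Type*} [Fintype κ] {Θ : Set (EuclideanSpace ℝ κ)}

lemma proj_spec (hc : IsClosed Θ) (hne : Θ.Nonempty) (x : EuclideanSpace ℝ κ) :
    proj Θ x ∈ Θ ∧ ∀ z ∈ Θ, ‖x - proj Θ x‖ ≤ ‖x - z‖ := by
  obtain ⟨y, hy, hxy⟩ := hc.exists_infDist_eq_dist hne x
  refine Classical.epsilon_spec (p := fun y => y ∈ Θ ∧ ∀ z ∈ Θ, ‖x - y‖ ≤ ‖x - z‖) ⟨y, hy, ?_⟩
  intro z hz
  rw [← dist_eq_norm, ← dist_eq_norm, ← hxy]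
  exact Metric.infDist_le_dist_of_mem hz

/-- The angle at the nearest point between `x` and any `z ∈ Θ` is not acute; expand `‖x - z‖²` about
that point. -/
lemma norm_proj_sub_le (hconv : Convex ℝ Θ) (hc : IsClosed Θ) {z : EuclideanSpace ℝ κ}
    (hz : z ∈ Θ) (x : EuclideanSpace ℝ κ) : ‖proj Θ x - z‖ ≤ ‖x - z‖ := by
  obtain ⟨h1, h2⟩ := proj_spec hc ⟨z, hz⟩ x
  have : Nonempty Θ := ⟨⟨z, hz⟩⟩
  have h3 : ‖x - proj Θ x‖ = ⨅ w : Θ, ‖x - w‖ :=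
    le_antisymm (le_ciInf fun w => h2 w w.2)
      (ciInf_le ⟨0, Set.forall_mem_range.2 fun w => norm_nonneg _⟩ (⟨_, h1⟩ : Θ))
  have h4 := (norm_eq_iInf_iff_real_inner_le_zero hconv h1).1 h3 z hz
  have h5 : ‖x - z‖ ^ 2 = ‖x - proj Θ x‖ ^ 2 - 2 * inner ℝ (x - proj Θ x) (z - proj Θ x) +
      ‖z - proj Θ x‖ ^ 2 := by
    rw [← norm_sub_sq_real, sub_sub_sub_cancel_right]
  rw [norm_sub_rev (proj Θ x)]
  refine (sq_le_sq₀ (norm_nonneg _) (norm_nonneg _)).1 ?_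
  nlinarith [sq_nonneg ‖x - proj Θ x‖]

end Projection

/-! ### TD directions, the energy identity and pathwise bounds -/

section Algebra

variable {S A κ : Type*} [Fintype S] [DecidableEq S] [Fintype A] [Fintype κ]
  {M : MDP S A} {μ : S → A → ℝ} {p : S → ℝ} {φ : S → EuclideanSpace ℝ κ}

lemma linValue_eq_inner (θ : EuclideanSpace ℝ κ) (x : S) : linValue φ θ x = inner ℝ θ (φ x) := by
  simp [linValue, PiLp.inner_apply, mul_comm]

lemma linValue_sub (θ θ' : EuclideanSpace ℝ κ) (x : S) :
    linValue φ (θ - θ') x = linValue φ θ x - linValue φ θ' x := by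
  simp only [linValue_eq_inner, inner_sub_left]

lemma abs_linValue_le (hφ : ∀ x, ‖φ x‖ ≤ 1) (θ : EuclideanSpace ℝ κ) (x : S) :
    |linValue φ θ x| ≤ ‖θ‖ := by
  rw [linValue_eq_inner]
  calc |inner ℝ θ (φ x)| ≤ ‖θ‖ * ‖φ x‖ := abs_real_inner_le_norm _ _
    _ ≤ ‖θ‖ * 1 := by gcongr; exact hφ x
    _ = ‖θ‖ := mul_one _

/-- The temporal difference of the transition from `x` to `y` under the action `c`. -/
def tdError (M : MDP S A) (φ : S → EuclideanSpace ℝ κ) (θ : EuclideanSpace ℝ κ)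
    (x : S) (c : A) (y : S) : ℝ :=
  M.reward x c y + M.discount * linValue φ θ y - linValue φ θ x

/-- The inner product of the TD(0) direction at `θ` with `θ - θ'`. -/
def tdProgress (M : MDP S A) (φ : S → EuclideanSpace ℝ κ) (θ' θ : EuclideanSpace ℝ κ)
    (x : S) (c : A) (y : S) : ℝ :=
  tdError M φ θ x c y * linValue φ (θ - θ') x

/-- The quadratic form `(1 - γ) ‖v‖_D² + γ ‖v‖_Dir²`. -/
def tdEnergy (M : MDP S A) (μ : S → A → ℝ) (p : S → ℝ) (v : S → ℝ) : ℝ :=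
  (1 - M.discount) * normSqD p v + M.discount * dirichletForm (transMatrix M μ) p v

lemma inner_tdDirection (θ θ' : EuclideanSpace ℝ κ) (s : ℕ → S) (a : ℕ → A) (t : ℕ) :
    inner ℝ (tdDirection M φ s a t θ) (θ - θ') =
      tdProgress M φ θ' θ (s t) (a t) (s (t + 1)) := by
  rw [tdDirection, inner_smul_left, real_inner_comm, ← linValue_eq_inner]
  rfl

lemma abs_tdError_le (hφ : ∀ x, ‖φ x‖ ≤ 1) {rmax : ℝ} (hr : ∀ x c y, |M.reward x c y| ≤ rmax)
    (θ : EuclideanSpace ℝ κ) (x : S) (c : A) (y : S) :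
    |tdError M φ θ x c y| ≤ rmax + 2 * ‖θ‖ := by
  have h1 := abs_le.1 (hr x c y)
  have h2 : |M.discount * linValue φ θ y| ≤ ‖θ‖ := by
    rw [abs_mul, abs_of_pos M.discount_pos]
    exact (mul_le_of_le_one_left (abs_nonneg _) M.discount_lt_one.le).trans
      (abs_linValue_le hφ θ y)
  have h2 := abs_le.1 h2
  have h3 := abs_le.1 (abs_linValue_le hφ θ x)
  rw [tdError, abs_le]
  constructor <;> linarith

lemma abs_tdError_sub_le (hφ : ∀ x, ‖φ x‖ ≤ 1) (θ θ' : EuclideanSpace ℝ κ) (x : S) (c : A)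
    (y : S) : |tdError M φ θ x c y - tdError M φ θ' x c y| ≤ 2 * ‖θ - θ'‖ := by
  have h2 : |M.discount * linValue φ (θ - θ') y| ≤ ‖θ - θ'‖ := by
    rw [abs_mul, abs_of_pos M.discount_pos]
    exact (mul_le_of_le_one_left (abs_nonneg _) M.discount_lt_one.le).trans
      (abs_linValue_le hφ _ y)
  have h3 := abs_linValue_le hφ (θ - θ') x
  have h4 : tdError M φ θ x c y - tdError M φ θ' x c y =
      M.discount * linValue φ (θ - θ') y - linValue φ (θ - θ') x := by
    simp only [tdError, linValue_sub]
    ring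
  rw [h4]
  exact (abs_sub _ _).trans (by linarith)

lemma norm_tdDirection_le (hφ : ∀ x, ‖φ x‖ ≤ 1) {rmax : ℝ}
    (hr : ∀ x c y, |M.reward x c y| ≤ rmax) (θ : EuclideanSpace ℝ κ) (s : ℕ → S) (a : ℕ → A)
    (t : ℕ) : ‖tdDirection M φ s a t θ‖ ≤ rmax + 2 * ‖θ‖ := by
  rw [tdDirection, norm_smul, Real.norm_eq_abs]
  exact (mul_le_of_le_one_right (abs_nonneg _) (hφ _)).trans
    (abs_tdError_le hφ hr θ (s t) (a t) (s (t + 1)))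

lemma abs_tdProgress_le (hφ : ∀ x, ‖φ x‖ ≤ 1) {rmax R : ℝ}
    (hr : ∀ x c y, |M.reward x c y| ≤ rmax) (hr0 : 0 ≤ rmax) {θ' θ : EuclideanSpace ℝ κ}
    (hθ' : ‖θ'‖ ≤ R) (hθ : ‖θ‖ ≤ R) (x : S) (c : A) (y : S) :
    |tdProgress M φ θ' θ x c y| ≤ (rmax + 2 * R) ^ 2 := by
  rw [tdProgress, abs_mul, sq]
  have h1 := abs_tdError_le hφ hr θ x c y
  have h2 := abs_linValue_le hφ (θ - θ') x
  have h3 := norm_sub_le θ θ'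
  have h4 := norm_nonneg θ
  refine mul_le_mul (by linarith) (by linarith) (abs_nonneg _) (by linarith)

/-- Product rule: each factor is at most `G = rmax + 2R`, the TD error is `2`-Lipschitz and the
linear value `1`-Lipschitz, whence `3G`. -/
lemma abs_tdProgress_sub_le (hφ : ∀ x, ‖φ x‖ ≤ 1) {rmax R : ℝ}
    (hr : ∀ x c y, |M.reward x c y| ≤ rmax) (hr0 : 0 ≤ rmax) {θ' θ ϑ : EuclideanSpace ℝ κ}
    (hθ' : ‖θ'‖ ≤ R) (hθ : ‖θ‖ ≤ R) (hϑ : ‖ϑ‖ ≤ R) (x : S) (c : A) (y : S) :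
    |tdProgress M φ θ' θ x c y - tdProgress M φ θ' ϑ x c y| ≤
      3 * (rmax + 2 * R) * ‖θ - ϑ‖ := by
  have h1 : tdProgress M φ θ' θ x c y - tdProgress M φ θ' ϑ x c y =
      (tdError M φ θ x c y - tdError M φ ϑ x c y) * linValue φ (θ - θ') x +
        tdError M φ ϑ x c y * linValue φ (θ - ϑ) x := by
    simp only [tdProgress, linValue_sub]
    ring
  have h2 := abs_tdError_sub_le (M := M) hφ θ ϑ x c y
  have h3 := abs_linValue_le hφ (θ - θ') x
  have h4 := abs_tdError_le hφ hr ϑ x c y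
  have h5 := abs_linValue_le hφ (θ - ϑ) x
  have h6 := norm_sub_le θ θ'
  have h7 := norm_nonneg (θ - ϑ)
  have h8 := norm_nonneg ϑ
  rw [h1]
  calc _ ≤ _ := abs_add_le _ _
    _ = |tdError M φ θ x c y - tdError M φ ϑ x c y| * |linValue φ (θ - θ') x| +
        |tdError M φ ϑ x c y| * |linValue φ (θ - ϑ) x| := by rw [abs_mul, abs_mul]
    _ ≤ (2 * ‖θ - ϑ‖) * (rmax + 2 * R) + (rmax + 2 * R) * ‖θ - ϑ‖ := by
        gcongr <;> linarith
    _ = _ := by ring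

/-- The first-order condition of the projection, obtained by varying `θ` in the direction `u`. -/
lemma sum_bellman_sub_mul_linValue (hp : p ∈ stdSimplex ℝ S) {θ : EuclideanSpace ℝ κ}
    (hθ : IsProjectedBellmanFixedPoint M μ p φ θ) (u : EuclideanSpace ℝ κ) :
    ∑ x, p x * (bellman M μ (linValue φ θ) x - linValue φ θ x) * linValue φ u x = 0 := by
  set b := ∑ x, p x * (bellman M μ (linValue φ θ) x - linValue φ θ x) * linValue φ u x with hb
  set c := normSqD p (linValue φ u) with hc
  have hc0 : 0 ≤ c := normSqD_nonneg hp _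
  have key : ∀ r : ℝ, 0 ≤ r ^ 2 * c - 2 * r * b := by
    intro r
    have h1 := hθ (θ + r • u)
    have h2 : normSqD p (bellman M μ (linValue φ θ) - linValue φ (θ + r • u)) =
        normSqD p (bellman M μ (linValue φ θ) - linValue φ θ) + (r ^ 2 * c - 2 * r * b) := by
      simp only [hb, hc, normSqD, Finset.mul_sum, ← Finset.sum_add_distrib,
        ← Finset.sum_sub_distrib]
      refine Finset.sum_congr rfl fun x _ => ?_
      simp only [Pi.sub_apply, linValue_eq_inner, inner_add_left, inner_smul_left]
      simp only [conj_trivial]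
      ring
    linarith
  by_contra hne
  -- The minimizer of the quadratic would be `b / c`; the shift avoids dividing by a possibly zero
  -- `c` and still makes the value negative.
  have h1 := key (b / (c + 1))
  have h2 : (b / (c + 1)) ^ 2 * c - 2 * (b / (c + 1)) * b = -(b ^ 2 * (c + 2) / (c + 1) ^ 2) := by
    field_simp
    ring
  rw [h2] at h1
  have : 0 < b ^ 2 * (c + 2) / (c + 1) ^ 2 := by positivity
  linarith

lemma isStationaryChain_transMatrix (hμ : IsPolicy μ) (hp : IsStationary (transMatrix M μ) p) :
    IsStationaryChain (transMatrix M μ) p where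
  nonneg x y := Finset.sum_nonneg fun c _ => mul_nonneg ((hμ x).1 c) ((M.trans_mem x c).1 y)
  row_sum x := by
    simp only [transMatrix, Matrix.of_apply]
    rw [Finset.sum_comm]
    simp_rw [← Finset.mul_sum, (M.trans_mem x _).2, mul_one, (hμ x).2]
  stationary := hp

lemma bellman_eq (v : S → ℝ) (x : S) :
    bellman M μ v x = stepMean M μ x (M.reward x) +
      M.discount * ∑ y, transMatrix M μ x y * v y := by
  simp only [bellman, stepMean, transMatrix, Matrix.of_apply, Finset.sum_mul, Finset.mul_sum]
  rw [Finset.sum_comm (f := fun y c => M.discount * (μ x c * M.trans x c y * v y)),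
    ← Finset.sum_add_distrib]
  refine Finset.sum_congr rfl fun c _ => ?_
  rw [← Finset.sum_add_distrib]
  exact Finset.sum_congr rfl fun y _ => by ring

/-- The mean TD(0) direction is a splitting of the gradient of the quadratic form `tdEnergy`. -/
lemma transitionMean_tdProgress (hμ : IsPolicy μ) (hp : p ∈ stdSimplex ℝ S)
    {θ' : EuclideanSpace ℝ κ} (hθ' : IsProjectedBellmanFixedPoint M μ p φ θ')
    (θ : EuclideanSpace ℝ κ) :
    transitionMean M μ p (tdProgress M φ θ' θ) = -tdEnergy M μ p (linValue φ (θ - θ')) := by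
  have h1 : ∀ x, stepMean M μ x (tdProgress M φ θ' θ x) =
      (bellman M μ (linValue φ θ) x - linValue φ θ x) * linValue φ (θ - θ') x := by
    intro x
    have h2 : linValue φ θ x = ∑ c, ∑ y, μ x c * M.trans x c y * linValue φ θ x :=
      (stepMean_const hμ x (linValue φ θ x)).symm
    conv_rhs => rw [bellman, h2]
    simp only [stepMean, ← Finset.sum_sub_distrib, Finset.sum_mul]
    refine Finset.sum_congr rfl fun c _ => Finset.sum_congr rfl fun y _ => ?_
    rw [tdProgress, tdError]
    ring
  have h2 := sum_bellman_sub_mul_linValue hp hθ' (θ - θ')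
  rw [transitionMean]
  simp only [h1]
  -- Subtracting the orthogonality relation at `θ'` cancels the rewards and leaves the form `⟪γ P v
  -- - v, v⟫` in `v = V_{θ - θ'}`.
  rw [← sub_zero (∑ x, _), ← h2, tdEnergy, normSqD, dirichletForm, Finset.mul_sum, Finset.mul_sum,
    ← Finset.sum_add_distrib, ← Finset.sum_neg_distrib, ← Finset.sum_sub_distrib]
  refine Finset.sum_congr rfl fun x _ => ?_
  simp only [bellman_eq, linValue_sub, mul_sub, Finset.sum_sub_distrib]
  ring

/-- Either nonnegative part of the energy alone suffices: the Dirichlet part by Poincaré, or the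
norm part because centring does not increase the norm. -/
lemma variance_le_min_mul_tdEnergy (h : IsStationaryChain (transMatrix M μ) p)
    (hirr : (transMatrix M μ).IsIrreducible) (v : S → ℝ) :
    variance p v ≤ min (invSpectralGap (transMatrix M μ) p / M.discount)
      (1 / (1 - M.discount)) * tdEnergy M μ p v := by
  have h0 := M.discount_pos
  have h1 : 0 < 1 - M.discount := sub_pos.2 M.discount_lt_one
  have h2 := normSqD_nonneg h.stationary.1 v
  have h3 := h.dirichletForm_nonneg v
  have h4 := h.half_le_invSpectralGap hirr
  rw [tdEnergy]
  rcases min_choice (invSpectralGap (transMatrix M μ) p / M.discount)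
    (1 / (1 - M.discount)) with hm | hm <;> rw [hm, mul_add]
  · have h5 : invSpectralGap (transMatrix M μ) p / M.discount *
        (M.discount * dirichletForm (transMatrix M μ) p v) =
        invSpectralGap (transMatrix M μ) p * dirichletForm (transMatrix M μ) p v := by
      field_simp
    have h6 := h.variance_le_invSpectralGap_mul hirr v
    have h7 : 0 ≤ invSpectralGap (transMatrix M μ) p / M.discount *
        ((1 - M.discount) * normSqD p v) := by positivity
    linarith
  · have h5 : 1 / (1 - M.discount) * ((1 - M.discount) * normSqD p v) = normSqD p v := by
      field_simp
    have h6 := variance_le_normSqD h.stationary.1 v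
    have h7 : 0 ≤ 1 / (1 - M.discount) *
        (M.discount * dirichletForm (transMatrix M μ) p v) := by positivity
    linarith

lemma half_le_min (h : IsStationaryChain (transMatrix M μ) p)
    (hirr : (transMatrix M μ).IsIrreducible) :
    1 / 2 ≤ min (invSpectralGap (transMatrix M μ) p / M.discount) (1 / (1 - M.discount)) := by
  have h0 := M.discount_pos
  have h1 := M.discount_lt_one
  have h4 := h.half_le_invSpectralGap hirr
  refine le_min ?_ ?_
  · rw [le_div_iff₀ h0]
    linarith
  · rw [le_div_iff₀ (by linarith)]
    linarith

section Path

variable {Θ : Set (EuclideanSpace ℝ κ)} {α : ℕ → ℝ} {θ₀ : EuclideanSpace ℝ κ} (s : ℕ → S)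
  (a : ℕ → A)

lemma tdIterate_succ_mem (hc : IsClosed Θ) (hne : Θ.Nonempty) (t : ℕ) :
    tdIterate M φ Θ α θ₀ s a (t + 1) ∈ Θ :=
  (proj_spec hc hne _).1

lemma norm_tdIterate_succ_sub_sq_le (hconv : Convex ℝ Θ) (hc : IsClosed Θ)
    {z : EuclideanSpace ℝ κ} (hz : z ∈ Θ) (t : ℕ) :
    ‖tdIterate M φ Θ α θ₀ s a (t + 1) - z‖ ^ 2 ≤ ‖tdIterate M φ Θ α θ₀ s a t - z‖ ^ 2 +
      2 * α t * tdProgress M φ z (tdIterate M φ Θ α θ₀ s a t) (s t) (a t) (s (t + 1)) +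
      α t ^ 2 * ‖tdDirection M φ s a t (tdIterate M φ Θ α θ₀ s a t)‖ ^ 2 := by
  set θ := tdIterate M φ Θ α θ₀ s a t with hθ
  have h1 : ‖tdIterate M φ Θ α θ₀ s a (t + 1) - z‖ ≤
      ‖θ - z + α t • tdDirection M φ s a t θ‖ := by
    rw [sub_add_eq_add_sub]
    exact norm_proj_sub_le hconv hc hz _
  calc _ ≤ ‖θ - z + α t • tdDirection M φ s a t θ‖ ^ 2 := by gcongr
    _ = _ := by
        rw [norm_add_sq_real, inner_smul_right, real_inner_comm, inner_tdDirection, norm_smul,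
          mul_pow, Real.norm_eq_abs, sq_abs]
        ring

lemma norm_tdIterate_succ_sub_le (hconv : Convex ℝ Θ) (hc : IsClosed Θ)
    {z : EuclideanSpace ℝ κ} (hz : z ∈ Θ) (t : ℕ) :
    ‖tdIterate M φ Θ α θ₀ s a (t + 1) - z‖ ≤ ‖tdIterate M φ Θ α θ₀ s a t - z‖ +
      |α t| * ‖tdDirection M φ s a t (tdIterate M φ Θ α θ₀ s a t)‖ := by
  set θ := tdIterate M φ Θ α θ₀ s a t with hθ
  calc _ ≤ ‖θ + α t • tdDirection M φ s a t θ - z‖ := norm_proj_sub_le hconv hc hz _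
    _ = ‖θ - z + α t • tdDirection M φ s a t θ‖ := by rw [sub_add_eq_add_sub]
    _ ≤ _ := (norm_add_le _ _).trans_eq (by rw [norm_smul, Real.norm_eq_abs])

/-- Projection fixes iterates already in `Θ`, so each step moves by at most `β G`. Membership at
time `t` is assumed because `θ₀` may lie outside `Θ`. -/
lemma norm_tdIterate_add_sub_le (hconv : Convex ℝ Θ) (hc : IsClosed Θ) (hφ : ∀ x, ‖φ x‖ ≤ 1)
    {rmax R : ℝ} (hr : ∀ x c y, |M.reward x c y| ≤ rmax) (hR : ∀ θ ∈ Θ, ‖θ‖ ≤ R)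
    {t : ℕ} (ht : tdIterate M φ Θ α θ₀ s a t ∈ Θ) {β : ℝ} (k : ℕ)
    (hα : ∀ i < k, |α (t + i)| ≤ β) :
    tdIterate M φ Θ α θ₀ s a (t + k) ∈ Θ ∧
    ‖tdIterate M φ Θ α θ₀ s a (t + k) - tdIterate M φ Θ α θ₀ s a t‖ ≤
      k * (β * (rmax + 2 * R)) := by
  induction k with
  | zero => simpa using ht
  | succ k ih =>
    obtain ⟨h1, h2⟩ := ih fun i hi => hα i (by omega)
    refine ⟨tdIterate_succ_mem s a hc ⟨_, ht⟩ _, ?_⟩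
    have h3 := norm_tdIterate_succ_sub_le (M := M) (φ := φ) (α := α) (θ₀ := θ₀) s a hconv hc h1
      (t + k)
    rw [sub_self, norm_zero, zero_add] at h3
    have h4 : |α (t + k)| * ‖tdDirection M φ s a (t + k) (tdIterate M φ Θ α θ₀ s a (t + k))‖ ≤
        β * (rmax + 2 * R) := by
      have h5 := norm_tdDirection_le hφ hr (tdIterate M φ Θ α θ₀ s a (t + k)) s a (t + k)
      have h6 := hR _ h1
      have h7 := hα k (by omega)
      exact mul_le_mul h7 (by linarith) (norm_nonneg _) ((abs_nonneg _).trans h7)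
    have h5 := norm_sub_le_norm_sub_add_norm_sub (tdIterate M φ Θ α θ₀ s a (t + k + 1))
      (tdIterate M φ Θ α θ₀ s a (t + k)) (tdIterate M φ Θ α θ₀ s a t)
    push_cast
    rw [← add_assoc]
    linarith

lemma avgReward_eq (T : ℕ) :
    avgReward M s a T = 1 / (T + 1 : ℝ) * ∑ t ∈ Finset.range (T + 1), rewardAt M s a t := by
  induction T with
  | zero => simp [avgReward]
  | succ T ih =>
    rw [avgReward, ih, Finset.sum_range_succ _ (T + 1)]
    push_cast
    have : (T : ℝ) + 1 ≠ 0 := by positivity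
    have : (T : ℝ) + 2 ≠ 0 := by positivity
    have : (T : ℝ) + 1 + 1 ≠ 0 := by positivity
    field_simp
    ring

lemma normSqD_meanAdjustedOutput_sub_le (hp : p ∈ stdSimplex ℝ S) (T : ℕ) (V : S → ℝ)
    (θ' : EuclideanSpace ℝ κ) :
    normSqD p (meanAdjustedOutput M p φ Θ α θ₀ s a T - V) ≤
      2 * variance p (linValue φ (tdAverage M φ Θ α θ₀ s a T - θ')) +
        2 * normSqD p (linValue φ θ' - V) +
        (avgReward M s a T / (1 - M.discount) - mean p V) ^ 2 := by
  set θ := tdAverage M φ Θ α θ₀ s a T with hθ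
  set c := avgReward M s a T / (1 - M.discount) with hc
  have h1 : meanAdjustedOutput M p φ Θ α θ₀ s a T - V = fun x =>
      (linValue φ (θ - θ') x + (linValue φ θ' - V) x) -
        mean p (fun x => linValue φ (θ - θ') x + (linValue φ θ' - V) x) + (c - mean p V) := by
    have h2 : (fun x => linValue φ (θ - θ') x + (linValue φ θ' - V) x) =
        fun x => linValue φ θ x + -V x := by
      ext x
      rw [linValue_sub, Pi.sub_apply]
      ring
    have h3 : mean p (fun x => -V x) = -mean p V := by simp [mean]
    rw [h2, mean_add, h3]
    ext x
    rw [Pi.sub_apply, meanAdjustedOutput, linValue_sub, Pi.sub_apply, ← hθ, ← hc]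
    ring
  rw [h1, normSqD_sub_mean_add hp]
  have h2 := variance_add_le hp (linValue φ (θ - θ')) (linValue φ θ' - V)
  have h3 := variance_le_normSqD hp (linValue φ θ' - V)
  linarith

lemma variance_linValue_tdAverage_sub_le (hp : p ∈ stdSimplex ℝ S) {T : ℕ} (hT : 0 < T)
    (θ' : EuclideanSpace ℝ κ) :
    variance p (linValue φ (tdAverage M φ Θ α θ₀ s a T - θ')) ≤ 1 / (T : ℝ) *
      ∑ t ∈ Finset.range T, variance p (linValue φ (tdIterate M φ Θ α θ₀ s a t - θ')) := by
  have h1 : linValue φ (tdAverage M φ Θ α θ₀ s a T - θ') = fun x => 1 / (T : ℝ) *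
      ∑ t ∈ Finset.range T, linValue φ (tdIterate M φ Θ α θ₀ s a t - θ') x := by
    ext x
    have hT' : (T : ℝ) ≠ 0 := by positivity
    simp only [linValue_eq_inner, inner_sub_left, Finset.sum_sub_distrib, tdAverage,
      inner_smul_left, sum_inner, conj_trivial, Finset.sum_const, Finset.card_range, nsmul_eq_mul]
    field_simp
  rw [h1]
  exact variance_average_le hp T _

end Path

end Algebra

lemma mixTime_spec {m ρ ε : ℝ} (hm : 0 < m) (hρ : 0 < ρ) (hρ1 : ρ < 1) (hε : 0 < ε) :
    1 ≤ mixTime m ρ ε ∧ ∀ k, mixTime m ρ ε ≤ k → m * ρ ^ k ≤ ε := by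
  have hne : {t : ℕ | 1 ≤ t ∧ m * ρ ^ t ≤ ε}.Nonempty := by
    obtain ⟨n, hn⟩ := exists_pow_lt_of_lt_one (div_pos hε hm) hρ1
    refine ⟨n + 1, Nat.le_add_left 1 n, ?_⟩
    rw [lt_div_iff₀ hm] at hn
    have : ρ ^ (n + 1) ≤ ρ ^ n := pow_le_pow_of_le_one hρ.le hρ1.le n.le_succ
    nlinarith
  obtain ⟨h1, h2⟩ := Nat.sInf_mem hne
  refine ⟨h1, fun k hk => le_trans ?_ h2⟩
  exact mul_le_mul_of_nonneg_left (pow_le_pow_of_le_one hρ.le hρ1.le hk) hm.le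

lemma sum_range_ite_lt_le (N k : ℕ) {B : ℝ} (hB : 0 ≤ B) :
    ∑ i ∈ Finset.range N, (if i < k then B else 0) ≤ k * B := by
  rw [← Finset.sum_filter, Finset.sum_const, nsmul_eq_mul]
  refine mul_le_mul_of_nonneg_right (Nat.cast_le.2 ?_) hB
  calc _ ≤ (Finset.range k).card := Finset.card_le_card fun i hi => by
        simpa using (Finset.mem_filter.1 hi).2
    _ = k := Finset.card_range k

/-! ### Expected progress of projected TD(0) -/

section Expectation

variable {S A κ Ω : Type*} [Fintype S] [DecidableEq S] [Fintype A] [Fintype κ]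
  [MeasurableSpace Ω] {M : MDP S A} {μ : S → A → ℝ} {p : S → ℝ} {φ : S → EuclideanSpace ℝ κ}
  {ℙ : Measure Ω} {s : ℕ → Ω → S} {a : ℕ → Ω → A} {m ρ rmax : ℝ}

lemma abs_transitionMean_le (hμ : IsPolicy μ) (hp : p ∈ stdSimplex ℝ S) {g : S → A → S → ℝ}
    {B : ℝ} (hg : ∀ x c y, |g x c y| ≤ B) : |transitionMean M μ p g| ≤ B := by
  calc |transitionMean M μ p g| ≤ ∑ x, |p x * stepMean M μ x (g x)| :=
        Finset.abs_sum_le_sum_abs _ _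
    _ ≤ ∑ x, p x * B := by
        refine Finset.sum_le_sum fun x _ => ?_
        rw [abs_mul, abs_of_nonneg (hp.1 x)]
        exact mul_le_mul_of_nonneg_left (abs_stepMean_le hμ x (hg x)) (hp.1 x)
    _ = B := by rw [← Finset.sum_mul, hp.2, one_mul]

lemma transitionMean_sub (g g' : S → A → S → ℝ) :
    transitionMean M μ p (fun x c y => g x c y - g' x c y) =
      transitionMean M μ p g - transitionMean M μ p g' := by
  simp only [transitionMean, stepMean, mul_sub, Finset.sum_sub_distrib]

lemma transitionMean_const_mul (b : ℝ) (g : S → A → S → ℝ) :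
    transitionMean M μ p (fun x c y => b * g x c y) = b * transitionMean M μ p g := by
  simp only [transitionMean, stepMean, Finset.mul_sum]
  exact Finset.sum_congr rfl fun x _ => Finset.sum_congr rfl fun c _ =>
    Finset.sum_congr rfl fun y _ => by ring

lemma transitionMean_const (hμ : IsPolicy μ) (hp : p ∈ stdSimplex ℝ S) (b : ℝ) :
    transitionMean M μ p (fun _ _ _ => b) = b := by
  simp only [transitionMean, stepMean_const hμ, ← Finset.sum_mul, hp.2, one_mul]

lemma dependsOnHistory_rewardAt (t : ℕ) :
    DependsOnHistory s a (t + 1) (fun ω => rewardAt M (fun i => s i ω) (fun i => a i ω) t) :=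
  ((DependsOnHistory.state.mono t.le_succ).comp₂ DependsOnHistory.action M.reward).comp₂
    DependsOnHistory.state (fun f y => f y)

lemma dependsOnHistory_tdIterate (Θ : Set (EuclideanSpace ℝ κ)) (α : ℕ → ℝ)
    (θ₀ : EuclideanSpace ℝ κ) (t : ℕ) :
    DependsOnHistory s a t
      (fun ω => tdIterate M φ Θ α θ₀ (fun i => s i ω) (fun i => a i ω) t) := by
  induction t with
  | zero => exact DependsOnHistory.const θ₀
  | succ t ih =>
    intro ω ω' hω
    have h1 := ih.mono t.le_succ hω
    have h2 : s t ω = s t ω' := DependsOnHistory.state.mono t.le_succ hω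
    have h3 : a t ω = a t ω' := DependsOnHistory.action hω
    have h4 : s (t + 1) ω = s (t + 1) ω' := DependsOnHistory.state hω
    simp only at h1
    simp only [tdIterate, tdDirection, rewardAt, h1, h2, h3, h4]

lemma dependsOnHistory_tdAverage (Θ : Set (EuclideanSpace ℝ κ)) (α : ℕ → ℝ)
    (θ₀ : EuclideanSpace ℝ κ) (T : ℕ) :
    DependsOnHistory s a T
      (fun ω => tdAverage M φ Θ α θ₀ (fun i => s i ω) (fun i => a i ω) T) := by
  intro ω ω' hω
  simp only [tdAverage]
  rw [Finset.sum_congr rfl fun t ht =>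
    (dependsOnHistory_tdIterate Θ α θ₀ t).mono (Finset.mem_range.1 ht).le hω]

lemma dependsOnHistory_avgReward (T : ℕ) :
    DependsOnHistory s a (T + 1)
      (fun ω => avgReward M (fun i => s i ω) (fun i => a i ω) T) := by
  simp only [avgReward_eq]
  exact (DependsOnHistory.sum _ fun t ht => (dependsOnHistory_rewardAt t).mono
    (Nat.succ_le_of_lt (Finset.mem_range.1 ht))).comp _

lemma dependsOnHistory_meanAdjustedOutput (Θ : Set (EuclideanSpace ℝ κ)) (α : ℕ → ℝ)
    (θ₀ : EuclideanSpace ℝ κ) (T : ℕ) :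
    DependsOnHistory s a (T + 1)
      (fun ω => meanAdjustedOutput M p φ Θ α θ₀ (fun i => s i ω) (fun i => a i ω) T) :=
  ((dependsOnHistory_tdAverage Θ α θ₀ T).mono T.le_succ).comp₂ (dependsOnHistory_avgReward T)
    (fun θ r x => linValue φ θ x + (r / (1 - M.discount) - mean p (linValue φ θ)))

section Drift

variable {Θ : Set (EuclideanSpace ℝ κ)} {α : ℕ → ℝ} {θ₀ θ' : EuclideanSpace ℝ κ} {R : ℝ}

/-- The energy is minus a stationary mean of `tdProgress`, so it inherits the pointwise bound; the
Lipschitz bound below transfers likewise. -/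
lemma abs_tdEnergy_le (hμ : IsPolicy μ) (hp : p ∈ stdSimplex ℝ S) (hφ : ∀ x, ‖φ x‖ ≤ 1)
    (hr : ∀ x c y, |M.reward x c y| ≤ rmax) (hr0 : 0 ≤ rmax)
    (hfix : IsProjectedBellmanFixedPoint M μ p φ θ') (hθ' : ‖θ'‖ ≤ R)
    {θ : EuclideanSpace ℝ κ} (hθ : ‖θ‖ ≤ R) :
    |tdEnergy M μ p (linValue φ (θ - θ'))| ≤ (rmax + 2 * R) ^ 2 := by
  rw [← abs_neg, ← transitionMean_tdProgress hμ hp hfix]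
  exact abs_transitionMean_le hμ hp (abs_tdProgress_le hφ hr hr0 hθ' hθ)

lemma abs_tdEnergy_sub_le (hμ : IsPolicy μ) (hp : p ∈ stdSimplex ℝ S) (hφ : ∀ x, ‖φ x‖ ≤ 1)
    (hr : ∀ x c y, |M.reward x c y| ≤ rmax) (hr0 : 0 ≤ rmax)
    (hfix : IsProjectedBellmanFixedPoint M μ p φ θ') (hθ' : ‖θ'‖ ≤ R)
    {θ ϑ : EuclideanSpace ℝ κ} (hθ : ‖θ‖ ≤ R) (hϑ : ‖ϑ‖ ≤ R) :
    |tdEnergy M μ p (linValue φ (θ - θ')) - tdEnergy M μ p (linValue φ (ϑ - θ'))| ≤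
      3 * (rmax + 2 * R) * ‖θ - ϑ‖ := by
  have h := abs_transitionMean_le (M := M) hμ hp (abs_tdProgress_sub_le hφ hr hr0 hθ' hθ hϑ)
  rwa [transitionMean_sub, transitionMean_tdProgress hμ hp hfix,
    transitionMean_tdProgress hμ hp hfix, neg_sub_neg, abs_sub_comm] at h

lemma dependsOnHistory_tdProgress (t : ℕ) {X : Ω → EuclideanSpace ℝ κ}
    (hX : DependsOnHistory s a (t + 1) X) :
    DependsOnHistory s a (t + 1)
      (fun ω => tdProgress M φ θ' (X ω) (s t ω) (a t ω) (s (t + 1) ω)) :=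
  ((hX.comp₂ (DependsOnHistory.state.mono t.le_succ) (tdProgress M φ θ')).comp₂
    DependsOnHistory.action (fun f c => f c)).comp₂ DependsOnHistory.state (fun f y => f y)

/-- The Markovian bias of the TD(0) direction is controlled by looking back `k` steps. -/
lemma integral_tdProgress_le_of_lag [IsProbabilityMeasure ℙ] (h : IsTrajectory M μ p ℙ s a)
    (hμ : IsPolicy μ) (hp : p ∈ stdSimplex ℝ S)
    (hmix : MixesGeometrically (transMatrix M μ) p m ρ) (hφ : ∀ x, ‖φ x‖ ≤ 1)
    (hr : ∀ x c y, |M.reward x c y| ≤ rmax) (hr0 : 0 ≤ rmax)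
    (hfix : IsProjectedBellmanFixedPoint M μ p φ θ') (hconv : Convex ℝ Θ) (hc : IsClosed Θ)
    (hθ' : θ' ∈ Θ) (hR : ∀ θ ∈ Θ, ‖θ‖ ≤ R) {β : ℝ} (j k : ℕ)
    (hα : ∀ i ≤ j + 1 + k, |α i| ≤ β) (hk : m * ρ ^ k ≤ β) :
    ∫ ω, tdProgress M φ θ'
        (tdIterate M φ Θ α θ₀ (fun i => s i ω) (fun i => a i ω) (j + 1 + k))
        (s (j + 1 + k) ω) (a (j + 1 + k) ω) (s (j + 1 + k + 1) ω) ∂ℙ ≤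
      -∫ ω, tdEnergy M μ p (linValue φ
        (tdIterate M φ Θ α θ₀ (fun i => s i ω) (fun i => a i ω) (j + 1 + k) - θ')) ∂ℙ +
        (6 * k + 2) * β * (rmax + 2 * R) ^ 2 := by
  set X : ℕ → Ω → EuclideanSpace ℝ κ :=
    fun t ω => tdIterate M φ Θ α θ₀ (fun i => s i ω) (fun i => a i ω) t with hXdef
  -- Looking back lands at an index `j + 1 ≥ 1`, where the iterate is in `Θ` whatever `θ₀` is.
  set t := j + 1 + k with ht
  change ∫ ω, tdProgress M φ θ' (X t ω) (s t ω) (a t ω) (s (t + 1) ω) ∂ℙ ≤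
    -∫ ω, tdEnergy M μ p (linValue φ (X t ω - θ')) ∂ℙ + _
  have hXd : ∀ i, DependsOnHistory s a i (X i) := dependsOnHistory_tdIterate Θ α θ₀
  have hXm : ∀ i ω, X (i + 1) ω ∈ Θ := fun i ω => tdIterate_succ_mem _ _ hc ⟨θ', hθ'⟩ i
  have hmv : ∀ ω, ‖X t ω - X (j + 1) ω‖ ≤ k * (β * (rmax + 2 * R)) := fun ω =>
    (norm_tdIterate_add_sub_le _ _ hconv hc hφ hr hR (hXm j ω) k fun i hi =>
      hα _ (by omega)).2
  have hXt : ∀ ω, ‖X t ω‖ ≤ R := fun ω => by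
    have : t = j + k + 1 := by omega
    rw [this]
    exact hR _ (hXm _ ω)
  have hXj : ∀ ω, ‖X (j + 1) ω‖ ≤ R := fun ω => hR _ (hXm j ω)
  have hG : 0 ≤ rmax + 2 * R := by
    have := (norm_nonneg _).trans (hR _ hθ')
    positivity
  have hi1 := h.integrable_of_dependsOnHistory
    (dependsOnHistory_tdProgress (M := M) (φ := φ) (θ' := θ') t ((hXd t).mono t.le_succ))
  have hi2 := h.integrable_of_dependsOnHistory (dependsOnHistory_tdProgress (M := M) (φ := φ)
    (θ' := θ') t ((hXd (j + 1)).mono (by omega : j + 1 ≤ t + 1)))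
  have hi3 : ∀ i, Integrable (fun ω => tdEnergy M μ p (linValue φ (X i ω - θ'))) ℙ := fun i =>
    h.integrable_of_dependsOnHistory ((hXd i).comp fun θ => tdEnergy M μ p (linValue φ (θ - θ')))
  have hstep : ∀ ω, 3 * (rmax + 2 * R) * ‖X t ω - X (j + 1) ω‖ ≤
      3 * k * β * (rmax + 2 * R) ^ 2 := fun ω => by
    calc _ ≤ 3 * (rmax + 2 * R) * (k * (β * (rmax + 2 * R))) := by
          gcongr
          exact hmv ω
      _ = _ := by ring
  -- Freezing the iterate at time `j + 1` costs `3kβG²` here and again in the energy (`e2`); mixing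
  -- over lag `k` adds `2βG²`.
  have e1 : ∫ ω, tdProgress M φ θ' (X t ω) (s t ω) (a t ω) (s (t + 1) ω) ∂ℙ ≤
      ∫ ω, (tdProgress M φ θ' (X (j + 1) ω) (s t ω) (a t ω) (s (t + 1) ω) +
        3 * k * β * (rmax + 2 * R) ^ 2) ∂ℙ := by
    refine integral_mono hi1 (hi2.add (integrable_const _)) fun ω => ?_
    have h1 := (abs_le.1 (abs_tdProgress_sub_le (M := M) hφ hr hr0 (hR _ hθ') (hXt ω) (hXj ω)
      (s t ω) (a t ω) (s (t + 1) ω))).2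
    have h2 := hstep ω
    simp only
    linarith
  have e2 : ∫ ω, tdEnergy M μ p (linValue φ (X t ω - θ')) ∂ℙ ≤
      ∫ ω, (tdEnergy M μ p (linValue φ (X (j + 1) ω - θ')) +
        3 * k * β * (rmax + 2 * R) ^ 2) ∂ℙ := by
    refine integral_mono (hi3 t) ((hi3 (j + 1)).add (integrable_const _)) fun ω => ?_
    have h1 := (abs_le.1 (abs_tdEnergy_sub_le hμ hp hφ hr hr0 hfix (hR _ hθ') (hXt ω)
      (hXj ω))).2
    have h2 := hstep ω
    simp only
    linarith
  rw [integral_add hi2 (integrable_const _), integral_const, probReal_univ, one_smul] at e1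
  rw [integral_add (hi3 _) (integrable_const _), integral_const, probReal_univ, one_smul] at e2
  have e3 := (abs_le.1 (h.abs_integral_transition_sub_le hμ hmix (hXd (j + 1)) k
    (g := tdProgress M φ θ') fun ω => abs_tdProgress_le hφ hr hr0 (hR _ hθ') (hXj ω))).2
  simp only [transitionMean_tdProgress hμ hp hfix, integral_neg, ← ht] at e3
  have e4 : 2 * (m * ρ ^ k) * (rmax + 2 * R) ^ 2 ≤ 2 * β * (rmax + 2 * R) ^ 2 := by gcongr
  linarith

/-- The crude substitute for early times, when there are not yet enough steps to look back. -/
lemma integral_tdProgress_le [IsProbabilityMeasure ℙ] (h : IsTrajectory M μ p ℙ s a)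
    (hμ : IsPolicy μ) (hp : p ∈ stdSimplex ℝ S) (hφ : ∀ x, ‖φ x‖ ≤ 1)
    (hr : ∀ x c y, |M.reward x c y| ≤ rmax) (hr0 : 0 ≤ rmax)
    (hfix : IsProjectedBellmanFixedPoint M μ p φ θ') (hc : IsClosed Θ)
    (hθ' : θ' ∈ Θ) (hR : ∀ θ ∈ Θ, ‖θ‖ ≤ R) (j : ℕ) :
    ∫ ω, tdProgress M φ θ'
        (tdIterate M φ Θ α θ₀ (fun i => s i ω) (fun i => a i ω) (j + 1))
        (s (j + 1) ω) (a (j + 1) ω) (s (j + 1 + 1) ω) ∂ℙ ≤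
      -∫ ω, tdEnergy M μ p (linValue φ
        (tdIterate M φ Θ α θ₀ (fun i => s i ω) (fun i => a i ω) (j + 1) - θ')) ∂ℙ +
        2 * (rmax + 2 * R) ^ 2 := by
  have hXd := dependsOnHistory_tdIterate (M := M) (φ := φ) (s := s) (a := a) Θ α θ₀ (j + 1)
  have hi1 := h.integrable_of_dependsOnHistory
    (dependsOnHistory_tdProgress (M := M) (φ := φ) (θ' := θ') (j + 1) (hXd.mono (j + 1).le_succ))
  have hi3 := h.integrable_of_dependsOnHistory
    (hXd.comp fun θ => tdEnergy M μ p (linValue φ (θ - θ')))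
  have hi4 : Integrable (fun ω => -tdEnergy M μ p (linValue φ
      (tdIterate M φ Θ α θ₀ (fun i => s i ω) (fun i => a i ω) (j + 1) - θ'))) ℙ := hi3.neg
  have key := integral_mono hi1 (hi4.add (integrable_const (2 * (rmax + 2 * R) ^ 2)))
    fun ω => ?_
  · simp only [Pi.add_apply] at key
    rwa [integral_add hi4 (integrable_const _), integral_const, probReal_univ, one_smul,
      integral_neg] at key
  · have hX := hR _ (tdIterate_succ_mem (M := M) (φ := φ) (α := α) (θ₀ := θ₀)
      (fun i => s i ω) (fun i => a i ω) hc ⟨θ', hθ'⟩ j)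
    have h1 := (abs_le.1 (abs_tdProgress_le hφ hr hr0 (hR _ hθ') hX (s (j + 1) ω) (a (j + 1) ω)
      (s (j + 1 + 1) ω))).2
    have h2 := (abs_le.1 (abs_tdEnergy_le hμ hp hφ hr hr0 hfix (hR _ hθ') hX)).2
    simp only [Pi.add_apply]
    linarith

/-- Telescoping the squared distance to `θ'`, from the first iterate sure to be in `Θ`. Each step
costs `2β(6τ + 2)βG²` of bias and `β²G²` from the squared direction; the first `τ` steps pay a crude
`4βG²` extra. -/
lemma sum_integral_tdEnergy_le [IsProbabilityMeasure ℙ] (h : IsTrajectory M μ p ℙ s a)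
    (hμ : IsPolicy μ) (hp : p ∈ stdSimplex ℝ S)
    (hmix : MixesGeometrically (transMatrix M μ) p m ρ) (hφ : ∀ x, ‖φ x‖ ≤ 1)
    (hr : ∀ x c y, |M.reward x c y| ≤ rmax) (hr0 : 0 ≤ rmax)
    (hfix : IsProjectedBellmanFixedPoint M μ p φ θ') (hconv : Convex ℝ Θ) (hc : IsClosed Θ)
    (hθ' : θ' ∈ Θ) (hR : ∀ θ ∈ Θ, ‖θ‖ ≤ R) {β : ℝ} (hβ : 0 ≤ β) {τ : ℕ} (hτ : m * ρ ^ τ ≤ β)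
    (N : ℕ) (hα : ∀ i ≤ N, α i = β) :
    2 * β * ∑ j ∈ Finset.range N, ∫ ω, tdEnergy M μ p (linValue φ
        (tdIterate M φ Θ α θ₀ (fun i => s i ω) (fun i => a i ω) (j + 1) - θ')) ∂ℙ +
      ∫ ω, ‖tdIterate M φ Θ α θ₀ (fun i => s i ω) (fun i => a i ω) (N + 1) - θ'‖ ^ 2 ∂ℙ ≤
    ∫ ω, ‖tdIterate M φ Θ α θ₀ (fun i => s i ω) (fun i => a i ω) 1 - θ'‖ ^ 2 ∂ℙ +
      N * ((12 * τ + 5) * β ^ 2 * (rmax + 2 * R) ^ 2) +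
      ∑ j ∈ Finset.range N, (if j < τ then 4 * β * (rmax + 2 * R) ^ 2 else 0) := by
  induction N with
  | zero => simp
  | succ N ih =>
    have ih := ih fun i hi => hα i (by omega)
    set X : ℕ → Ω → EuclideanSpace ℝ κ :=
      fun t ω => tdIterate M φ Θ α θ₀ (fun i => s i ω) (fun i => a i ω) t with hXdef
    have hXd : ∀ i, DependsOnHistory s a i (X i) := dependsOnHistory_tdIterate Θ α θ₀
    have hG : 0 ≤ (rmax + 2 * R) ^ 2 := sq_nonneg _
    have e1 : ∫ ω, tdProgress M φ θ' (X (N + 1) ω) (s (N + 1) ω) (a (N + 1) ω)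
          (s (N + 1 + 1) ω) ∂ℙ ≤ -∫ ω, tdEnergy M μ p (linValue φ (X (N + 1) ω - θ')) ∂ℙ +
        ((6 * τ + 2) * β * (rmax + 2 * R) ^ 2 +
          if N < τ then 2 * (rmax + 2 * R) ^ 2 else 0) := by
      split_ifs with hN
      · have := integral_tdProgress_le (α := α) (θ₀ := θ₀) h hμ hp hφ hr hr0 hfix hc hθ' hR N
        have h2 : 0 ≤ (6 * τ + 2) * β * (rmax + 2 * R) ^ 2 := by positivity
        linarith
      · obtain ⟨j, rfl⟩ : ∃ j, N = j + τ := ⟨N - τ, by omega⟩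
        have := integral_tdProgress_le_of_lag (α := α) (θ₀ := θ₀) (β := β) h hμ hp hmix hφ hr hr0
          hfix hconv hc hθ' hR j τ
          (fun i hi => by rw [hα i (by omega), abs_of_nonneg hβ]) hτ
        rw [show j + 1 + τ = j + τ + 1 by ring] at this
        linarith
    have hi1 := h.integrable_of_dependsOnHistory (dependsOnHistory_tdProgress (M := M) (φ := φ)
      (θ' := θ') (N + 1) ((hXd (N + 1)).mono (N + 1).le_succ))
    have hi2 : ∀ i, Integrable (fun ω => ‖X i ω - θ'‖ ^ 2) ℙ := fun i =>
      h.integrable_of_dependsOnHistory ((hXd i).comp fun θ => ‖θ - θ'‖ ^ 2)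
    have hi4 : Integrable (fun ω => 2 * β * tdProgress M φ θ' (X (N + 1) ω) (s (N + 1) ω)
        (a (N + 1) ω) (s (N + 1 + 1) ω) + β ^ 2 * (rmax + 2 * R) ^ 2) ℙ :=
      (hi1.const_mul _).add (integrable_const _)
    have e2 : ∫ ω, ‖X (N + 1 + 1) ω - θ'‖ ^ 2 ∂ℙ ≤ ∫ ω, (‖X (N + 1) ω - θ'‖ ^ 2 +
        (2 * β * tdProgress M φ θ' (X (N + 1) ω) (s (N + 1) ω) (a (N + 1) ω)
          (s (N + 1 + 1) ω) + β ^ 2 * (rmax + 2 * R) ^ 2)) ∂ℙ := by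
      refine integral_mono (hi2 _) ((hi2 _).add hi4) fun ω => ?_
      have h1 := norm_tdIterate_succ_sub_sq_le (M := M) (φ := φ) (α := α) (θ₀ := θ₀)
        (fun i => s i ω) (fun i => a i ω) hconv hc hθ' (N + 1)
      have h2 := norm_tdDirection_le hφ hr (X (N + 1) ω) (fun i => s i ω) (fun i => a i ω) (N + 1)
      have h3 := hR _ (tdIterate_succ_mem (M := M) (φ := φ) (α := α) (θ₀ := θ₀)
        (fun i => s i ω) (fun i => a i ω) hc ⟨θ', hθ'⟩ N)
      rw [hα (N + 1) le_rfl] at h1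
      have h4 : β ^ 2 * ‖tdDirection M φ (fun i => s i ω) (fun i => a i ω) (N + 1)
          (X (N + 1) ω)‖ ^ 2 ≤ β ^ 2 * (rmax + 2 * R) ^ 2 := by
        gcongr
        simp only [hXdef] at h2 ⊢
        linarith
      simp only [hXdef] at h4 ⊢
      linarith
    rw [integral_add (hi2 _) hi4, integral_add (hi1.const_mul _) (integrable_const _), integral_const_mul, integral_const,
      probReal_univ, one_smul] at e2
    rw [Finset.sum_range_succ, Finset.sum_range_succ]
    have e3 := mul_le_mul_of_nonneg_left e1 (mul_nonneg two_pos.le hβ)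
    have e4 : 2 * β * (if N < τ then 2 * (rmax + 2 * R) ^ 2 else 0) =
        if N < τ then 4 * β * (rmax + 2 * R) ^ 2 else 0 := by
      split_ifs <;> ring
    rw [mul_add, mul_add (2 * β) ((6 * τ + 2) * β * (rmax + 2 * R) ^ 2), e4] at e3
    push_cast
    linarith

/-- The convergence rate of projected TD(0) with step size `1 / √T`, for the variance of the
error of the averaged iterate. -/
lemma integral_variance_tdAverage_le [IsProbabilityMeasure ℙ] (h : IsTrajectory M μ p ℙ s a)
    (hμ : IsPolicy μ) (hp : IsStationary (transMatrix M μ) p)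
    (hirr : (transMatrix M μ).IsIrreducible)
    (hmix : MixesGeometrically (transMatrix M μ) p m ρ) (hφ : ∀ x, ‖φ x‖ ≤ 1)
    (hr : ∀ x c y, |M.reward x c y| ≤ rmax) (hr0 : 0 ≤ rmax)
    (hfix : IsProjectedBellmanFixedPoint M μ p φ θ') (hconv : Convex ℝ Θ) (hc : IsClosed Θ)
    (hθ' : θ' ∈ Θ) (hR : ∀ θ ∈ Θ, ‖θ‖ ≤ R) {T : ℕ} (hT : 0 < T)
    (hα : ∀ i ≤ T, α i = 1 / √(T : ℝ)) {τ : ℕ} (hτ : m * ρ ^ τ ≤ 1 / √(T : ℝ)) :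
    ∫ ω, variance p (linValue φ
        (tdAverage M φ Θ α θ₀ (fun i => s i ω) (fun i => a i ω) T - θ')) ∂ℙ ≤
      11 * ((‖θ' - θ₀‖ ^ 2 + (rmax + 2 * R) ^ 2 * (1 + τ)) / √(T : ℝ) *
        min (invSpectralGap (transMatrix M μ) p / M.discount) (1 / (1 - M.discount))) := by
  set X : ℕ → Ω → EuclideanSpace ℝ κ :=
    fun t ω => tdIterate M φ Θ α θ₀ (fun i => s i ω) (fun i => a i ω) t with hXdef
  have hXd : ∀ i, DependsOnHistory s a i (X i) := dependsOnHistory_tdIterate Θ α θ₀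
  have hchain := isStationaryChain_transMatrix hμ hp
  set κ' := min (invSpectralGap (transMatrix M μ) p / M.discount) (1 / (1 - M.discount)) with hκ
  have hκ2 : 1 / 2 ≤ κ' := half_le_min hchain hirr
  set G := rmax + 2 * R with hGdef
  set d := ‖θ' - θ₀‖ with hd
  have hd0 : 0 ≤ d := norm_nonneg _
  have hR0 : 0 ≤ R := (norm_nonneg _).trans (hR _ hθ')
  have hG : 0 ≤ G := by positivity
  have hT1 : (1 : ℝ) ≤ T := Nat.one_le_cast.2 hT
  have hsq : 1 ≤ √(T : ℝ) := Real.one_le_sqrt.2 hT1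
  set β := 1 / √(T : ℝ) with hβ
  have hβ0 : 0 < β := by positivity
  have hβ1 : β ≤ 1 := by rw [hβ, div_le_one (by linarith)]; exact hsq
  have hβT : β ^ 2 * T = 1 := by
    rw [hβ, div_pow, Real.sq_sqrt (by linarith)]
    field_simp
  obtain ⟨N, rfl⟩ : ∃ N, T = N + 1 := ⟨T - 1, by omega⟩
  -- The step from `θ₀` is bounded through `‖θ₀‖ ≤ d + R`, which gives `(3d + G)² ≤ 18d² + 2G²`.
  have hfirst : ∀ ω, ‖X 1 ω - θ'‖ ^ 2 ≤ 18 * d ^ 2 + 2 * G ^ 2 := by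
    intro ω
    have h1 := norm_tdIterate_succ_sub_le (M := M) (φ := φ) (α := α) (θ₀ := θ₀)
      (fun i => s i ω) (fun i => a i ω) hconv hc hθ' 0
    rw [hα 0 (by omega), abs_of_nonneg hβ0.le] at h1
    simp only [tdIterate.eq_1] at h1
    have h2 := norm_tdDirection_le hφ hr θ₀ (fun i => s i ω) (fun i => a i ω) 0
    have h3 : ‖θ₀‖ ≤ d + R := by
      have := norm_sub_norm_le θ₀ θ'
      rw [norm_sub_rev] at this
      linarith [hR _ hθ']
    rw [norm_sub_rev θ₀] at h1
    have h4 : β * ‖tdDirection M φ (fun i => s i ω) (fun i => a i ω) 0 θ₀‖ ≤ 1 * (G + 2 * d) :=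
      mul_le_mul hβ1 (by linarith) (norm_nonneg _) zero_le_one
    have h5 : ‖X 1 ω - θ'‖ ≤ 3 * d + G := by
      simp only [hXdef]
      linarith
    have h6 := norm_nonneg (X 1 ω - θ')
    nlinarith [sq_nonneg (3 * d - G)]
  have hD1 : ∫ ω, ‖X 1 ω - θ'‖ ^ 2 ∂ℙ ≤ 18 * d ^ 2 + 2 * G ^ 2 := by
    refine (integral_mono (h.integrable_of_dependsOnHistory
      ((hXd 1).comp fun θ => ‖θ - θ'‖ ^ 2)) (integrable_const _) hfirst).trans_eq (by simp)
  have hsum := sum_integral_tdEnergy_le (θ₀ := θ₀) h hμ hp.1 hmix hφ hr hr0 hfix hconv hc hθ' hR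
    hβ0.le hτ N (fun i hi => hα i (by omega))
  have hlast : 0 ≤ ∫ ω, ‖X (N + 1) ω - θ'‖ ^ 2 ∂ℙ := integral_nonneg fun ω => sq_nonneg _
  have hite := sum_range_ite_lt_le N τ (B := 4 * β * G ^ 2) (by positivity)
  set q : ℕ → ℝ := fun j => ∫ ω, tdEnergy M μ p (linValue φ (X (j + 1) ω - θ')) ∂ℙ with hq
  have hqsum : β ^ 2 * ∑ j ∈ Finset.range N, q j ≤ β * (9 * d ^ 2 + (7 / 2 + 8 * τ) * G ^ 2) := by
    have h1 : 2 * β * ∑ j ∈ Finset.range N, q j ≤ 18 * d ^ 2 + 2 * G ^ 2 +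
        N * ((12 * τ + 5) * β ^ 2 * G ^ 2) + τ * (4 * β * G ^ 2) := by linarith
    have h2 : N * ((12 * τ + 5) * β ^ 2 * G ^ 2) ≤ (12 * τ + 5) * G ^ 2 := by
      have : β ^ 2 * N ≤ 1 := by
        rw [← hβT]
        push_cast
        nlinarith [sq_nonneg β]
      calc _ = (12 * τ + 5) * G ^ 2 * (β ^ 2 * N) := by ring
        _ ≤ (12 * τ + 5) * G ^ 2 * 1 := by gcongr
        _ = _ := mul_one _
    have h3 : τ * (4 * β * G ^ 2) ≤ τ * (4 * 1 * G ^ 2) := by gcongr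
    have h4 : 2 * β * ∑ j ∈ Finset.range N, q j ≤
        2 * (9 * d ^ 2 + (7 / 2 + 8 * τ) * G ^ 2) := by linarith
    have h5 : β * ∑ j ∈ Finset.range N, q j ≤ 9 * d ^ 2 + (7 / 2 + 8 * τ) * G ^ 2 := by linarith
    calc _ = β * (β * ∑ j ∈ Finset.range N, q j) := by ring
      _ ≤ _ := by gcongr
  have hi3 : ∀ i, Integrable (fun ω => tdEnergy M μ p (linValue φ (X i ω - θ'))) ℙ := fun i =>
    h.integrable_of_dependsOnHistory ((hXd i).comp fun θ => tdEnergy M μ p (linValue φ (θ - θ')))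
  -- The term of `θ₀` is split off and bounded by `d²`, since the energy sum starts at the iterate
  -- `1`.
  have havg : ∫ ω, variance p (linValue φ
        (tdAverage M φ Θ α θ₀ (fun i => s i ω) (fun i => a i ω) (N + 1) - θ')) ∂ℙ ≤
      ∫ ω, β ^ 2 * (∑ j ∈ Finset.range N,
        κ' * tdEnergy M μ p (linValue φ (X (j + 1) ω - θ')) + d ^ 2) ∂ℙ := by
    refine integral_mono (h.integrable_of_dependsOnHistory
      ((dependsOnHistory_tdAverage Θ α θ₀ (N + 1)).comp fun θ =>
        variance p (linValue φ (θ - θ'))))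
      (((integrable_finsetSum _ fun j _ => (hi3 (j + 1)).const_mul κ').add
        (integrable_const _)).const_mul _) fun ω => ?_
    refine (variance_linValue_tdAverage_sub_le (fun i => s i ω) (fun i => a i ω) hp.1 hT
      θ').trans ?_
    rw [show 1 / ((N + 1 : ℕ) : ℝ) = β ^ 2 by
      rw [← hβT]
      field_simp, Finset.sum_range_succ']
    refine mul_le_mul_of_nonneg_left (add_le_add (Finset.sum_le_sum fun j _ => ?_) ?_)
      (sq_nonneg β)
    · exact variance_le_min_mul_tdEnergy hchain hirr _
    · rw [hd, norm_sub_rev]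
      exact (variance_le_normSqD hp.1 _).trans (normSqD_le_of_abs_le hp.1 (abs_linValue_le hφ _))
  rw [integral_const_mul, integral_add (integrable_finsetSum _ fun j _ =>
    (hi3 (j + 1)).const_mul κ') (integrable_const _), integral_finsetSum _ fun j _ =>
    (hi3 (j + 1)).const_mul κ', integral_const, probReal_univ, one_smul] at havg
  simp only [integral_const_mul, ← Finset.mul_sum] at havg
  refine havg.trans ?_
  have h1 : κ' * (β ^ 2 * ∑ j ∈ Finset.range N, q j) ≤
      κ' * (β * (9 * d ^ 2 + (7 / 2 + 8 * τ) * G ^ 2)) := by gcongr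
  -- Uses `β ≤ 1` and `1 ≤ 2κ'`; this is where the lower bound on the inverse gap pays off.
  have h2 : β ^ 2 * d ^ 2 ≤ 2 * κ' * (β * d ^ 2) := by
    calc β ^ 2 * d ^ 2 = β * (β * d ^ 2) := by ring
      _ ≤ 2 * κ' * (β * d ^ 2) := by
          gcongr
          linarith
  -- The `d²` terms add up to `9 + 2 = 11`; this slack raises `7/2` and `8τ` to the same `11`.
  have h3 : κ' * (β * ((15 / 2 + 3 * τ) * G ^ 2)) ≥ 0 := by positivity
  calc β ^ 2 * (κ' * ∑ j ∈ Finset.range N, q j + d ^ 2)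
      = κ' * (β ^ 2 * ∑ j ∈ Finset.range N, q j) + β ^ 2 * d ^ 2 := by ring
    _ ≤ κ' * (β * (9 * d ^ 2 + (7 / 2 + 8 * τ) * G ^ 2)) + 2 * κ' * (β * d ^ 2) +
        κ' * (β * ((15 / 2 + 3 * τ) * G ^ 2)) := by linarith
    _ = 11 * ((d ^ 2 + G ^ 2 * (1 + τ)) * β * κ') := by ring
    _ = _ := by rw [hβ]; ring

end Drift

end Expectation

/-! ### The average reward as an estimate of the mean value -/

section Reward

variable {S A Ω : Type*} [Fintype S] [DecidableEq S] [Fintype A] [MeasurableSpace Ω]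
  {M : MDP S A} {μ : S → A → ℝ} {p : S → ℝ} {ℙ : Measure Ω} {s : ℕ → Ω → S} {a : ℕ → Ω → A}
  {m ρ rmax : ℝ}

/-- The reward at time `t` is known at time `t + 1`. Decoupling from there leaves the stationary
mean of a centred reward, which is zero. -/
lemma abs_integral_mul_reward_le [IsProbabilityMeasure ℙ] (h : IsTrajectory M μ p ℙ s a)
    (hμ : IsPolicy μ) (hp : p ∈ stdSimplex ℝ S)
    (hmix : MixesGeometrically (transMatrix M μ) p m ρ)
    (hr : ∀ x c y, |M.reward x c y| ≤ rmax) (t k : ℕ) :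
    |∫ ω, (rewardAt M (fun i => s i ω) (fun i => a i ω) t - transitionMean M μ p M.reward) *
      (rewardAt M (fun i => s i ω) (fun i => a i ω) (t + 1 + k) -
        transitionMean M μ p M.reward) ∂ℙ| ≤ 2 * (m * ρ ^ k) * (4 * rmax ^ 2) := by
  set r' := transitionMean M μ p M.reward with hr'
  have hbd : ∀ x c y, |M.reward x c y - r'| ≤ 2 * rmax := fun x c y =>
    (abs_sub _ _).trans (by linarith [hr x c y, abs_transitionMean_le (M := M) hμ hp hr])
  have key := h.abs_integral_transition_sub_le hμ hmix
    ((dependsOnHistory_rewardAt (M := M) (s := s) (a := a) t).comp fun q => q - r') k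
    (g := fun b x c y => b * (M.reward x c y - r')) (B := 4 * rmax ^ 2) fun ω x c y => by
      rw [abs_mul]
      have h1 : |rewardAt M (fun i => s i ω) (fun i => a i ω) t - r'| ≤ 2 * rmax := hbd _ _ _
      calc _ ≤ 2 * rmax * (2 * rmax) :=
            mul_le_mul h1 (hbd x c y) (abs_nonneg _) ((abs_nonneg _).trans h1)
        _ = _ := by ring
  have h0 : ∀ b : ℝ, transitionMean M μ p (fun x c y => b * (M.reward x c y - r')) = 0 := by
    intro b
    rw [transitionMean_const_mul, transitionMean_sub M.reward (fun _ _ _ => r'),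
      transitionMean_const hμ hp, hr', sub_self, mul_zero]
  simp only [h0, integral_zero, sub_zero] at key
  exact key

/-- The variance of the sum of `N` rewards grows linearly in `N`. -/
lemma integral_sum_reward_sub_sq_le [IsProbabilityMeasure ℙ] (h : IsTrajectory M μ p ℙ s a)
    (hμ : IsPolicy μ) (hp : p ∈ stdSimplex ℝ S)
    (hmix : MixesGeometrically (transMatrix M μ) p m ρ)
    (hr : ∀ x c y, |M.reward x c y| ≤ rmax) {L τ : ℕ}
    (hτ : ∀ k, τ ≤ k → m * ρ ^ k ≤ 1 / (2 * (L : ℝ))) (N : ℕ) (hN : N ≤ L) :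
    ∫ ω, (∑ t ∈ Finset.range N, (rewardAt M (fun i => s i ω) (fun i => a i ω) t -
      transitionMean M μ p M.reward)) ^ 2 ∂ℙ ≤ N * ((12 + 8 * τ) * rmax ^ 2) := by
  set r' := transitionMean M μ p M.reward with hr'
  set Y : ℕ → Ω → ℝ := fun t ω => rewardAt M (fun i => s i ω) (fun i => a i ω) t - r' with hY
  have hYd : ∀ t, DependsOnHistory s a (t + 1) (Y t) := fun t =>
    (dependsOnHistory_rewardAt (M := M) t).comp fun q => q - r'
  have hYb : ∀ t ω, |Y t ω| ≤ 2 * rmax := fun t ω =>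
    (abs_sub _ _).trans (by
      linarith [hr (s t ω) (a t ω) (s (t + 1) ω), abs_transitionMean_le (M := M) hμ hp hr,
        show |rewardAt M (fun i => s i ω) (fun i => a i ω) t| ≤ rmax from hr _ _ _])
  -- `L` stays fixed while `N` grows, so the mixing accuracy is the same at every stage.
  induction N with
  | zero => simp
  | succ N ih =>
    have ih := ih (by omega)
    have hL : (0 : ℝ) < L := by exact_mod_cast (by omega : 0 < L)
    have hSd : DependsOnHistory s a (N + 1) (fun ω => ∑ t ∈ Finset.range N, Y t ω) :=
      DependsOnHistory.sum _ fun t ht => (hYd t).mono (by have := Finset.mem_range.1 ht; omega)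
    have hpair : ∀ t, t < N → Integrable (fun ω => Y t ω * Y N ω) ℙ := fun t ht =>
      h.integrable_of_dependsOnHistory
        (((hYd t).mono (by omega : t + 1 ≤ N + 1)).comp₂ (hYd N) (· * ·))
    have hmul : ∀ t u, |∫ ω, Y t ω * Y u ω ∂ℙ| ≤ 4 * rmax ^ 2 := by
      intro t u
      have := norm_integral_le_of_norm_le_const (μ := ℙ) (f := fun ω => Y t ω * Y u ω)
        (C := 4 * rmax ^ 2) (Filter.Eventually.of_forall fun ω => by
          rw [Real.norm_eq_abs, abs_mul]
          calc _ ≤ 2 * rmax * (2 * rmax) :=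
                mul_le_mul (hYb t ω) (hYb u ω) (abs_nonneg _) ((abs_nonneg _).trans (hYb t ω))
            _ = _ := by ring)
      simpa using this
    -- At most `τ` recent covariances take the trivial bound `4 rmax²`; the others are at most `4
    -- rmax² / L` and number at most `L`. Doubling this and adding the diagonal gives `12 + 8τ`.
    have hcov : ∀ t, t < N → ∫ ω, Y t ω * Y N ω ∂ℙ ≤
        4 * rmax ^ 2 / L + if N - 1 - t < τ then 4 * rmax ^ 2 else 0 := by
      intro t ht
      split_ifs with hlt
      · have h1 := (abs_le.1 (hmul t N)).2
        have h2 : 0 ≤ 4 * rmax ^ 2 / L := by positivity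
        linarith
      · have h1 := (abs_le.1 (abs_integral_mul_reward_le h hμ hp hmix hr t (N - 1 - t))).2
        rw [show t + 1 + (N - 1 - t) = N by omega] at h1
        have h2 := hτ (N - 1 - t) (by omega)
        calc _ ≤ 2 * (m * ρ ^ (N - 1 - t)) * (4 * rmax ^ 2) := h1
          _ ≤ 2 * (1 / (2 * (L : ℝ))) * (4 * rmax ^ 2) := by gcongr
          _ = _ := by
              field_simp
              ring
    have hcross : ∫ ω, (∑ t ∈ Finset.range N, Y t ω) * Y N ω ∂ℙ ≤
        4 * rmax ^ 2 + τ * (4 * rmax ^ 2) := by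
      simp only [Finset.sum_mul]
      rw [integral_finsetSum _ fun t ht => hpair t (Finset.mem_range.1 ht)]
      refine (Finset.sum_le_sum fun t ht => hcov t (Finset.mem_range.1 ht)).trans ?_
      rw [Finset.sum_add_distrib, Finset.sum_const, Finset.card_range, nsmul_eq_mul,
        Finset.sum_range_reflect (fun i => if i < τ then 4 * rmax ^ 2 else 0) N]
      refine add_le_add ?_ (sum_range_ite_lt_le N τ (by positivity))
      rw [mul_div_assoc', div_le_iff₀ hL, mul_comm]
      gcongr
      omega
    have hi1 := h.integrable_of_dependsOnHistory (hSd.comp (· ^ 2))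
    have hi2 := h.integrable_of_dependsOnHistory (hSd.comp₂ (hYd N) (· * ·))
    have hi3 := h.integrable_of_dependsOnHistory ((hYd N).comp₂ (hYd N) (· * ·))
    have hi4 : Integrable (fun ω => 2 * ((∑ t ∈ Finset.range N, Y t ω) * Y N ω) +
        Y N ω * Y N ω) ℙ := (hi2.const_mul 2).add hi3
    have hexp : ∫ ω, (∑ t ∈ Finset.range (N + 1), Y t ω) ^ 2 ∂ℙ =
        ∫ ω, (∑ t ∈ Finset.range N, Y t ω) ^ 2 ∂ℙ +
          (2 * ∫ ω, (∑ t ∈ Finset.range N, Y t ω) * Y N ω ∂ℙ + ∫ ω, Y N ω * Y N ω ∂ℙ) := by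
      rw [← integral_const_mul, ← integral_add (hi2.const_mul 2) hi3,
        ← integral_add hi1 hi4]
      congr 1
      ext ω
      simp only [Finset.sum_range_succ]
      ring
    rw [hexp]
    have h1 := (abs_le.1 (hmul N N)).2
    push_cast
    linarith

lemma integral_cond_eq [IsProbabilityMeasure ℙ] (h : IsTrajectory M μ p ℙ s a)
    (x : S) (hx : 0 < p x) (f : Ω → ℝ) :
    p x * ∫ ω, f ω ∂(ProbabilityTheory.cond ℙ (s 0 ⁻¹' {x})) =
      ∫ ω in s 0 ⁻¹' {x}, f ω ∂ℙ := by
  obtain ⟨ω₀⟩ := nonempty_of_isProbabilityMeasure ℙ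
  have h1 := h.measureReal_initial ⟨a 0 ω₀⟩ x
  rw [ProbabilityTheory.cond, integral_smul_measure, ENNReal.toReal_inv, smul_eq_mul,
    show (ℙ (s 0 ⁻¹' {x})).toReal = p x from h1]
  field_simp

/-- The mean of the value function is the mean reward divided by `1 - γ`. -/
lemma mean_valueFunction [IsProbabilityMeasure ℙ] (h : IsTrajectory M μ p ℙ s a)
    (hp : IsStationary (transMatrix M μ) p) (hpos : ∀ x, 0 < p x)
    (hr : ∀ x c y, |M.reward x c y| ≤ rmax) :
    mean p (valueFunction M ℙ s a) = transitionMean M μ p M.reward / (1 - M.discount) := by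
  obtain ⟨ω₀⟩ := nonempty_of_isProbabilityMeasure ℙ
  set F : ℕ → Ω → ℝ :=
    fun t ω => M.discount ^ t * rewardAt M (fun i => s i ω) (fun i => a i ω) t with hF
  have hFi : ∀ t, Integrable (F t) ℙ := fun t => h.integrable_of_dependsOnHistory
    ((dependsOnHistory_rewardAt (M := M) t).comp (M.discount ^ t * ·))
  have hFb : ∀ t ω, ‖F t ω‖ ≤ M.discount ^ t * rmax := fun t ω => by
    rw [hF, norm_mul, norm_pow, Real.norm_of_nonneg M.discount_pos.le]
    exact mul_le_mul_of_nonneg_left (hr _ _ _) (pow_nonneg M.discount_pos.le t)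
  have hgeom := (hasSum_geometric_of_lt_one M.discount_pos.le M.discount_lt_one)
  have hterm : ∀ x, HasSum (fun t => ∫ ω in s 0 ⁻¹' {x}, F t ω ∂ℙ)
      (p x * valueFunction M ℙ s a x) := by
    intro x
    have hne : ℙ (s 0 ⁻¹' {x}) ≠ 0 := by
      intro h0
      have h1 := h.measureReal_initial ⟨a 0 ω₀⟩ x
      rw [measureReal_def, h0, ENNReal.toReal_zero] at h1
      exact (hpos x).ne h1
    have hprob := ProbabilityTheory.cond_isProbabilityMeasure hne
    have hFi' : ∀ t, Integrable (F t) (ProbabilityTheory.cond ℙ (s 0 ⁻¹' {x})) := fun t =>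
      (hFi t).restrict.smul_measure (ENNReal.inv_ne_top.2 hne)
    have hsum := hasSum_integral_of_summable_integral_norm hFi' (by
      refine Summable.of_nonneg_of_le (fun t => integral_nonneg fun ω => norm_nonneg _)
        (fun t => ?_) (hgeom.summable.mul_right rmax)
      refine (integral_mono (hFi' t).norm (integrable_const _) (hFb t)).trans_eq ?_
      simp)
    have := hsum.mul_left (p x)
    simp only [integral_cond_eq h x (hpos x)] at this
    rwa [← integral_cond_eq h x (hpos x)] at this
  -- Summing over the initial state, weighted by `p`, undoes the conditioning; stationarity then
  -- makes the series geometric.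
  have htotal := hasSum_sum (s := Finset.univ) fun x _ => hterm x
  have hsplit : ∀ t, ∑ x, ∫ ω in s 0 ⁻¹' {x}, F t ω ∂ℙ =
      M.discount ^ t * transitionMean M μ p M.reward := by
    intro t
    rw [← h.integral_transition hp t, ← integral_const_mul]
    simp only [← integral_indicator (h.measurableSet_state 0 _)]
    rw [← integral_finsetSum _ fun x _ => (hFi t).indicator (h.measurableSet_state 0 x)]
    congr 1
    ext ω
    rw [Finset.sum_eq_single (s 0 ω)]
    · rw [Set.indicator_of_mem (by simp)]
      rfl
    · intro x _ hx
      exact Set.indicator_of_notMem (s := s 0 ⁻¹' {x}) (f := F t) (fun hmem => hx (Eq.symm hmem))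
    · simp
  simp only [hsplit] at htotal
  rw [mean, htotal.unique (hgeom.mul_right _), div_eq_inv_mul]

/-- The mean squared error of the average reward as an estimate of the mean value. -/
lemma integral_avgReward_sub_sq_le [IsProbabilityMeasure ℙ] (h : IsTrajectory M μ p ℙ s a)
    (hμ : IsPolicy μ) (hp : IsStationary (transMatrix M μ) p) (hpos : ∀ x, 0 < p x)
    (hmix : MixesGeometrically (transMatrix M μ) p m ρ)
    (hr : ∀ x c y, |M.reward x c y| ≤ rmax) {T τ : ℕ} (hT : 0 < T) (hτ1 : 1 ≤ τ)
    (hτ : ∀ k, τ ≤ k → m * ρ ^ k ≤ 1 / (2 * ((T : ℝ) + 1))) :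
    ∫ ω, (avgReward M (fun i => s i ω) (fun i => a i ω) T / (1 - M.discount) -
        mean p (valueFunction M ℙ s a)) ^ 2 ∂ℙ ≤
      20 * (rmax ^ 2 * τ / ((1 - M.discount) ^ 2 * T)) := by
  have hγ : 0 < 1 - M.discount := sub_pos.2 M.discount_lt_one
  have hT' : (0 : ℝ) < T := Nat.cast_pos.2 hT
  have hτ' : (1 : ℝ) ≤ τ := Nat.one_le_cast.2 hτ1
  -- `Ā_T` averages `T + 1` rewards, which matches the accuracy `1 / (2(T + 1))` of the mixing time.
  have h1 := integral_sum_reward_sub_sq_le h hμ hp.1 hmix hr (L := T + 1) (τ := τ)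
    (by simpa using hτ) (T + 1) le_rfl
  have h2 : ∀ ω, (avgReward M (fun i => s i ω) (fun i => a i ω) T / (1 - M.discount) -
        mean p (valueFunction M ℙ s a)) ^ 2 = 1 / ((1 - M.discount) ^ 2 * (T + 1) ^ 2) *
      (∑ t ∈ Finset.range (T + 1), (rewardAt M (fun i => s i ω) (fun i => a i ω) t -
        transitionMean M μ p M.reward)) ^ 2 := by
    intro ω
    have hT1 : (T : ℝ) + 1 ≠ 0 := by positivity
    rw [avgReward_eq, mean_valueFunction h hp hpos hr, Finset.sum_sub_distrib, Finset.sum_const,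
      Finset.card_range, nsmul_eq_mul, ← sub_div, div_pow]
    push_cast
    field_simp
  simp only [h2]
  rw [integral_const_mul]
  calc _ ≤ 1 / ((1 - M.discount) ^ 2 * ((T : ℝ) + 1) ^ 2) *
        ((T + 1 : ℕ) * ((12 + 8 * τ) * rmax ^ 2)) := by gcongr
    _ = (12 + 8 * τ) * rmax ^ 2 / ((1 - M.discount) ^ 2 * ((T : ℝ) + 1)) := by
        push_cast
        field_simp
    _ ≤ (12 * τ + 8 * τ) * rmax ^ 2 / ((1 - M.discount) ^ 2 * T) := by
        gcongr
        · linarith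
        · linarith
    _ = _ := by ring

end Reward

end MeanAdjustedTD

/-! ### Assembly of the bound -/

theorem corollary3 :
    ∃ C : ℝ, 0 < C ∧
      ∀ (n k K : ℕ)
        (M : MeanAdjustedTD.MDP (Fin n) (Fin k)) (μ : Fin n → Fin k → ℝ) (π : Fin n → ℝ)
        (φ : Fin n → EuclideanSpace ℝ (Fin K)) (θstar θ₀ : EuclideanSpace ℝ (Fin K))
        (Θ : Set (EuclideanSpace ℝ (Fin K))) (m ρ rmax R : ℝ) (α : ℕ → ℝ) (t₀ T : ℕ)
        (Ω : Type*) (_ : MeasurableSpace Ω) (ℙ : MeasureTheory.Measure Ω)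
        (s : ℕ → Ω → Fin n) (a : ℕ → Ω → Fin k),
        -- the policy, the induced Markov chain and its stationary distribution
        MeanAdjustedTD.IsPolicy μ →
        (MeanAdjustedTD.transMatrix M μ).IsIrreducible →
        MeanAdjustedTD.IsAperiodic (MeanAdjustedTD.transMatrix M μ) →
        MeanAdjustedTD.IsStationary (MeanAdjustedTD.transMatrix M μ) π →
        (∀ x b y, |M.reward x b y| ≤ rmax) →
        -- the features
        LinearIndependent ℝ (fun (l : Fin K) (x : Fin n) => φ x l) →
        (∀ x, ‖φ x‖ ^ 2 ≤ 1) →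
        -- geometric mixing, and the stationary trajectory
        0 < m → 0 < ρ → ρ < 1 →
        MeanAdjustedTD.MixesGeometrically (MeanAdjustedTD.transMatrix M μ) π m ρ →
        MeasureTheory.IsProbabilityMeasure ℙ →
        MeanAdjustedTD.IsTrajectory M μ π ℙ s a →
        -- the limit point of TD(0) and the constraint set
        MeanAdjustedTD.IsProjectedBellmanFixedPoint M μ π φ θstar →
        Convex ℝ Θ → IsClosed Θ → θstar ∈ Θ → (∀ θ ∈ Θ, ‖θ‖ ≤ R) →
        -- the number of steps and the step sizes
        IsGreatest {t : ℕ | t ≤ 2 * MeanAdjustedTD.mixTime m ρ (1 / (2 * ((t : ℝ) + 1)))} t₀ →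
        t₀ ≤ T →
        (∀ t ≤ T, α t = 1 / √(T : ℝ)) →
        MeasureTheory.Integrable
          (fun ω => MeanAdjustedTD.normSqD π
            (MeanAdjustedTD.meanAdjustedOutput M π φ Θ α θ₀ (fun t => s t ω) (fun t => a t ω) T -
              MeanAdjustedTD.valueFunction M ℙ s a)) ℙ ∧
        ∫ ω, MeanAdjustedTD.normSqD π
            (MeanAdjustedTD.meanAdjustedOutput M π φ Θ α θ₀ (fun t => s t ω) (fun t => a t ω) T -
              MeanAdjustedTD.valueFunction M ℙ s a) ∂ℙ ≤
          C * (MeanAdjustedTD.normSqD π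
                (MeanAdjustedTD.linValue φ θstar - MeanAdjustedTD.valueFunction M ℙ s a) +
            rmax ^ 2 * (MeanAdjustedTD.mixTime m ρ (1 / (2 * ((T : ℝ) + 1))) : ℝ) /
              ((1 - M.discount) ^ 2 * T) +
            (‖θstar - θ₀‖ ^ 2 +
                (rmax + 2 * R) ^ 2 * (1 + (MeanAdjustedTD.mixTime m ρ (1 / √(T : ℝ)) : ℝ))) /
              √(T : ℝ) *
              min (MeanAdjustedTD.invSpectralGap (MeanAdjustedTD.transMatrix M μ) π / M.discount)
                (1 / (1 - M.discount))) := by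
  -- `22 = 2 · 11` comes from the variance term; the reward term needs `20` and the approximation
  -- error `2`.
  refine ⟨22, by norm_num, ?_⟩
  intro n k K M μ π φ θstar θ₀ Θ m ρ rmax R α t₀ T Ω _ ℙ s a hμ hirr _ hπ hr _ hφ hm hρ hρ1 hmix
    hℙ htraj hfix hconv hc hmem hR ht₀ hT hα
  obtain ⟨ω₀⟩ := nonempty_of_isProbabilityMeasure ℙ
  have hr0 : 0 ≤ rmax := (abs_nonneg _).trans (hr (s 0 ω₀) (a 0 ω₀) (s 0 ω₀))
  have hφ' : ∀ x, ‖φ x‖ ≤ 1 := fun x => (sq_le_one_iff₀ (norm_nonneg _)).1 (hφ x)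
  have hTpos : 0 < T := by
    -- Mixing times are at least `1`, so `2` satisfies the inequality that defines `t₀`; hence `T`
    -- is positive.
    have h2 : 2 ≤ t₀ := ht₀.2 (by
      have := (MeanAdjustedTD.mixTime_spec (ε := 1 / (2 * (((2 : ℕ) : ℝ) + 1))) hm hρ hρ1
        (by positivity)).1
      simp only [Set.mem_ofPred_eq]
      omega)
    omega
  have hT' : (0 : ℝ) < T := Nat.cast_pos.2 hTpos
  have hchain := MeanAdjustedTD.isStationaryChain_transMatrix hμ hπ
  obtain ⟨hτ1, hτ⟩ := MeanAdjustedTD.mixTime_spec (ε := 1 / (2 * ((T : ℝ) + 1))) hm hρ hρ1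
    (by positivity)
  obtain ⟨-, hτ'⟩ := MeanAdjustedTD.mixTime_spec (ε := 1 / √(T : ℝ)) hm hρ hρ1 (by positivity)
  have hreward := MeanAdjustedTD.integral_avgReward_sub_sq_le htraj hμ hπ (hchain.pos hirr) hmix hr
    hTpos hτ1 hτ
  have htd := MeanAdjustedTD.integral_variance_tdAverage_le (θ₀ := θ₀) htraj hμ hπ hirr hmix hφ' hr
    hr0 hfix hconv hc hmem hR hTpos hα (hτ' _ le_rfl)
  set V := MeanAdjustedTD.valueFunction M ℙ s a with hV
  have hint : MeasureTheory.Integrable (fun ω => MeanAdjustedTD.normSqD π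
      (MeanAdjustedTD.meanAdjustedOutput M π φ Θ α θ₀ (fun t => s t ω) (fun t => a t ω) T - V))
      ℙ := htraj.integrable_of_dependsOnHistory
    ((MeanAdjustedTD.dependsOnHistory_meanAdjustedOutput Θ α θ₀ T).comp
      fun v => MeanAdjustedTD.normSqD π (v - V))
  refine ⟨hint, ?_⟩
  have hi1 := htraj.integrable_of_dependsOnHistory
    ((MeanAdjustedTD.dependsOnHistory_tdAverage (M := M) (φ := φ) (s := s) (a := a) Θ α θ₀ T).comp
      fun θ => 2 * MeanAdjustedTD.variance π (MeanAdjustedTD.linValue φ (θ - θstar)) +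
        2 * MeanAdjustedTD.normSqD π (MeanAdjustedTD.linValue φ θstar - V))
  have hi0 := htraj.integrable_of_dependsOnHistory
    ((MeanAdjustedTD.dependsOnHistory_tdAverage (M := M) (φ := φ) (s := s) (a := a) Θ α θ₀ T).comp
      fun θ => MeanAdjustedTD.variance π (MeanAdjustedTD.linValue φ (θ - θstar)))
  have hi2 := htraj.integrable_of_dependsOnHistory
    ((MeanAdjustedTD.dependsOnHistory_avgReward (M := M) (s := s) (a := a) T).comp
      fun r => (r / (1 - M.discount) - MeanAdjustedTD.mean π V) ^ 2)
  have hmain := MeasureTheory.integral_mono hint (hi1.add hi2) fun ω =>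
    MeanAdjustedTD.normSqD_meanAdjustedOutput_sub_le (fun t => s t ω) (fun t => a t ω) hπ.1 T V
      θstar
  simp only [Pi.add_apply] at hmain
  rw [MeasureTheory.integral_add hi1 hi2, MeasureTheory.integral_add (hi0.const_mul 2)
    (MeasureTheory.integrable_const _), MeasureTheory.integral_const_mul,
    MeasureTheory.integral_const, MeasureTheory.probReal_univ, one_smul] at hmain
  have h1 := MeanAdjustedTD.normSqD_nonneg hπ.1 (MeanAdjustedTD.linValue φ θstar - V)
  have h2 : 0 ≤ rmax ^ 2 * (MeanAdjustedTD.mixTime m ρ (1 / (2 * ((T : ℝ) + 1))) : ℝ) /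
      ((1 - M.discount) ^ 2 * T) := by positivity
  linarith
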